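/- Let $k,m,n\ge 0$ be integers with $k\le\min(m,n)$, let $Z$ be a set of positions of an $m\times n$ matrix, and let $X=(X_{a,b})$ be a random $m\times n$ matrix (defined on some probability space) such that $X_{a,b}=0$ almost surely for $(a,b)\in Z$, while the entries $X_{a,b}$ with $(a,b)\notin Z$ are independent exponential random variables of intensity $1$. A $k$-assignment is a set of $k$ matrix positions, no two of them in the same row or in the same column; it is optimal if the sum of the entries of $X$ in its positions is minimal among all $k$-assignments. A set of rows and columns covers $Z$ if every position in $Z$ lies in one of these rows or columns. A partial $(k-1)$-cover is a subset of some set that consists of exactly $k-1$ rows and columns and covers $Z$ (for $k=0$ there are none). Let $r$ be a row that contains no position of $Z$, and let $\overline{d}_{i,0}$ be the number of partial $(k-1)$-covers that consist of $i$ rows and no columns and do not contain $r$. Then the probability that some element of row $r$ belongs to the optimal $k$-assignment is $$\frac1m\sum_{i=0}^{k-1}\frac{\overline{d}_{i,0}}{\binom{m-1}{i}} .$$ The optimal $k$-assignment need not be unique; the formula holds both for the probability that some optimal $k$-assignment uses row $r$ and for the probability that every optimal $k$-assignment uses row $r$. -/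

import Mathlib

open MeasureTheory ProbabilityTheory

namespace RandomAssignment

/-- A `k`-assignment: a set of `k` matrix positions, no two in the same row or column. -/
structure IsAssignment {m n : ℕ} (k : ℕ) (s : Finset (Fin m × Fin n)) : Prop where
  card_eq : s.card = k
  rows : Set.InjOn Prod.fst (s : Set (Fin m × Fin n))
  cols : Set.InjOn Prod.snd (s : Set (Fin m × Fin n))

/-- The sum of the entries of `A` in the positions of `s`. -/
def cost {m n : ℕ} (A : Fin m → Fin n → ℝ) (s : Finset (Fin m × Fin n)) : ℝ :=
  ∑ p ∈ s, A p.1 p.2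

/-- `s` is a `k`-assignment of minimal cost. -/
def IsOptimal {m n : ℕ} (A : Fin m → Fin n → ℝ) (k : ℕ) (s : Finset (Fin m × Fin n)) : Prop :=
  IsAssignment k s ∧ ∀ t : Finset (Fin m × Fin n), IsAssignment k t → cost A s ≤ cost A t

/-- Some element of the row `r` belongs to `s`. -/
def UsesRow {m n : ℕ} (s : Finset (Fin m × Fin n)) (r : Fin m) : Prop :=
  ∃ j : Fin n, (r, j) ∈ s

/-- The random `m × n` matrix `X`, with the number `k`, is a standard random assignment problem
with set of zeros `Z`: the entries in `Z` are zero, and the other entries are independent and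
exponentially distributed with intensity 1. -/
structure IsStandardRAP {Ω : Type*} [MeasurableSpace Ω] (μ : Measure Ω) {m n : ℕ} (k : ℕ)
    (Z : Finset (Fin m × Fin n)) (X : Fin m → Fin n → Ω → ℝ) : Prop where
  le_min : k ≤ min m n
  zero : ∀ p ∈ Z, ∀ᵐ ω ∂μ, X p.1 p.2 ω = 0
  law : ∀ p ∉ Z, HasLaw (X p.1 p.2) (expMeasure 1) μ
  indep : iIndepFun (fun p : {p : Fin m × Fin n // p ∉ Z} => X p.1.1 p.1.2) μ

/-- The rows in `R` together with the columns in `C` cover `Z`. -/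
def Covers {m n : ℕ} (Z : Finset (Fin m × Fin n)) (R : Finset (Fin m)) (C : Finset (Fin n)) :
    Prop :=
  ∀ p ∈ Z, p.1 ∈ R ∨ p.2 ∈ C

/-- `(R, C)` is a partial `(k-1)`-cover of `Z`: it is contained in a cover `(R', C')` consisting of
exactly `k - 1` rows and columns. For `k = 0` there are none. -/
def IsPartialCover {m n : ℕ} (Z : Finset (Fin m × Fin n)) (k : ℕ) (R : Finset (Fin m))
    (C : Finset (Fin n)) : Prop :=
  ∃ (R' : Finset (Fin m)) (C' : Finset (Fin n)),
    R ⊆ R' ∧ C ⊆ C' ∧ Covers Z R' C' ∧ R'.card + C'.card + 1 = k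

/-- The number of partial `(k-1)`-covers of `Z` with `i` rows and `j` columns that do not contain
the row `r`. -/
noncomputable def coverCoeffAvoiding {m n : ℕ} (Z : Finset (Fin m × Fin n)) (k : ℕ) (r : Fin m)
    (i j : ℕ) : ℕ :=
  Set.ncard {c : Finset (Fin m) × Finset (Fin n) |
    IsPartialCover Z k c.1 c.2 ∧ c.1.card = i ∧ c.2.card = j ∧ r ∉ c.1}

end RandomAssignment
/-!
Almost surely the matrix is generic: distinct sets of positions outside `Z` have distinct sums. Let
`F` be the set of rows common to all optimal `j`-assignments, and `C` the set of columns with a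
position of `Z` outside `F`. If no `(j + 1)`-assignment lies in `Z`, then `F` and `C` form a cover
of `Z` with exactly `j` lines, `F` grows with `j`, and exactly one row `a` outside `F` has a
position outside `Z` in the optimal `(j + 1)`-assignments. Exchanging two rows outside `F`, in the
columns outside `C` only, preserves the law of the matrix and `F`, so the new row `a` is uniform
outside `F`.

For a set `B` of rows, arrange the rows outside `B` in random order and consider the probability
that the rows before `r`, together with `B`, extend to a cover of `Z` with fewer than `k` lines.
At `B = ∅` this is the formula, and averaging over the first row shows that it is a martingale along
`B = F`, by uncrossing covers. For the last step it becomes the indicator of the event that `r` is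
common to all optimal `k`-assignments.

The combinatorial facts about `F` and `C` come from linear programming duality: Egerváry's theorem,
applied after a small perturbation on the rows in `F`, gives one dual solution that certifies the
optima for `j` and `j + 1` simultaneously and is positive on `F`.
-/

namespace RandomAssignment

section Matchings

variable {α β : Type*}

/-- A set of positions, no two in the same row or column: an assignment of unspecified size. -/
structure IsMatching (s : Finset (α × β)) : Prop where
  rows : Set.InjOn Prod.fst (s : Set (α × β))
  cols : Set.InjOn Prod.snd (s : Set (α × β))

theorem IsMatching.subset {s t : Finset (α × β)} (hs : IsMatching s) (h : t ⊆ s) :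
    IsMatching t :=
  ⟨hs.rows.mono (Finset.coe_subset.2 h), hs.cols.mono (Finset.coe_subset.2 h)⟩

theorem IsMatching.eq_of_fst {s : Finset (α × β)} (hs : IsMatching s) {p q : α × β} (hp : p ∈ s)
    (hq : q ∈ s) (h : p.1 = q.1) : p = q :=
  hs.rows (Finset.mem_coe.2 hp) (Finset.mem_coe.2 hq) h

theorem IsMatching.eq_of_snd {s : Finset (α × β)} (hs : IsMatching s) {p q : α × β} (hp : p ∈ s)
    (hq : q ∈ s) (h : p.2 = q.2) : p = q :=
  hs.cols (Finset.mem_coe.2 hp) (Finset.mem_coe.2 hq) h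

theorem IsMatching.exists_fst_ne_of_card_lt {s t : Finset (α × β)} (hs : IsMatching s)
    (h : t.card < s.card) : ∃ p ∈ s, ∀ q ∈ t, q.1 ≠ p.1 := by
  classical
  have hlt : (t.image Prod.fst).card < (s.image Prod.fst).card :=
    Finset.card_image_le.trans_lt (h.trans_eq (Finset.card_image_of_injOn hs.rows).symm)
  obtain ⟨i, his, hit⟩ := Finset.exists_mem_notMem_of_card_lt_card hlt
  obtain ⟨p, hp, rfl⟩ := Finset.mem_image.1 his
  exact ⟨p, hp, fun q hq hqp => hit (Finset.mem_image.2 ⟨q, hq, hqp⟩)⟩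

/-- No position of `s` lies in both a row of `R` and a column outside `C`, or in both a row outside
`R` and a column of `C`. -/
def SplitsAt (s : Finset (α × β)) (R : Finset α) (C : Finset β) : Prop :=
  ∀ p ∈ s, p.1 ∈ R ↔ p.2 ∈ C

/-- A step of an alternating path from row to row: along `s` to a column, and back along `t`. -/
def AltStep (s t : Finset (α × β)) (i i' : α) : Prop :=
  ∃ b, (i, b) ∈ s ∧ (i', b) ∈ t

variable [DecidableEq α]

open scoped Classical in
/-- The rows on the alternating path of `s` and `t` that leaves the row `u` along `s`. -/
noncomputable def altRows (s t : Finset (α × β)) (u : α) : Finset α :=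
  {i ∈ insert u (t.image Prod.fst) | Relation.ReflTransGen (AltStep s t) u i}

theorem mem_altRows {s t : Finset (α × β)} {u i : α} :
    i ∈ altRows s t u ↔ Relation.ReflTransGen (AltStep s t) u i := by
  simp only [altRows, Finset.mem_filter, and_iff_right_iff_imp]
  intro h
  rcases h.cases_tail with rfl | ⟨_, -, b, -, hb⟩
  · exact Finset.mem_insert_self _ _
  · exact Finset.mem_insert_of_mem (Finset.mem_image_of_mem Prod.fst hb)

theorem self_mem_altRows (s t : Finset (α × β)) (u : α) : u ∈ altRows s t u :=
  mem_altRows.2 .refl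

theorem exists_mem_of_mem_altRows {s t : Finset (α × β)} {u i : α} (hi : i ∈ altRows s t u)
    (hiu : i ≠ u) : ∃ j ∈ altRows s t u, ∃ b, (j, b) ∈ s ∧ (i, b) ∈ t := by
  rcases (mem_altRows.1 hi).cases_tail with rfl | ⟨j, hj, hstep⟩
  · exact absurd rfl hiu
  · exact ⟨j, mem_altRows.2 hj, hstep⟩

theorem card_filter_altRows_le {s : Finset (α × β)} (hs : IsMatching s) (t : Finset (α × β))
    (u : α) : {p ∈ s | p.1 ∈ altRows s t u}.card ≤ {p ∈ t | p.1 ∈ altRows s t u}.card + 1 := by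
  have hle : {p ∈ s | p.1 ∈ altRows s t u}.card ≤ (altRows s t u).card :=
    Finset.card_le_card_of_injOn Prod.fst (fun p hp => (Finset.mem_filter.1 hp).2)
      (hs.subset (Finset.filter_subset _ _)).rows
  have hsub : (altRows s t u).erase u ⊆ {p ∈ t | p.1 ∈ altRows s t u}.image Prod.fst := by
    intro i hi
    obtain ⟨hiu, hi⟩ := Finset.mem_erase.1 hi
    obtain ⟨-, -, b, -, hb⟩ := exists_mem_of_mem_altRows hi hiu
    exact Finset.mem_image.2 ⟨(i, b), Finset.mem_filter.2 ⟨hb, hi⟩, rfl⟩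
  have hge := (Finset.card_le_card hsub).trans Finset.card_image_le
  rw [Finset.card_erase_of_mem (self_mem_altRows s t u)] at hge
  omega

/-- Replace the positions of `s` in the rows `R` by those of `t`. -/
def replaceOn (s t : Finset (α × β)) (R : Finset α) : Finset (α × β) :=
  {p ∈ s | p.1 ∉ R}.disjUnion {p ∈ t | p.1 ∈ R} <|
    Finset.disjoint_left.2 fun _ hs ht => (Finset.mem_filter.1 hs).2 (Finset.mem_filter.1 ht).2

theorem mem_replaceOn {s t : Finset (α × β)} {R : Finset α} {p : α × β} :
    p ∈ replaceOn s t R ↔ p ∈ s ∧ p.1 ∉ R ∨ p ∈ t ∧ p.1 ∈ R := by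
  simp only [replaceOn, Finset.mem_disjUnion, Finset.mem_filter]

theorem IsMatching.replaceOn {s t : Finset (α × β)} (hs : IsMatching s) (ht : IsMatching t)
    {R : Finset α} {C : Finset β} (hsC : ∀ p ∈ s, p.1 ∉ R → p.2 ∉ C)
    (htC : ∀ p ∈ t, p.1 ∈ R → p.2 ∈ C) : IsMatching (replaceOn s t R) := by
  constructor <;> intro p hp q hq h <;>
    rcases mem_replaceOn.1 hp with ⟨hp, hpR⟩ | ⟨hp, hpR⟩ <;>
    rcases mem_replaceOn.1 hq with ⟨hq, hqR⟩ | ⟨hq, hqR⟩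
  · exact hs.eq_of_fst hp hq h
  · exact absurd (h ▸ hqR) hpR
  · exact absurd (h ▸ hpR) hqR
  · exact ht.eq_of_fst hp hq h
  · exact hs.eq_of_snd hp hq h
  · exact absurd (h ▸ htC q hq hqR) (hsC p hp hpR)
  · exact absurd (h ▸ htC p hp hpR) (hsC q hq hqR)
  · exact ht.eq_of_snd hp hq h

theorem IsMatching.replaceOn_of_splitsAt {s t : Finset (α × β)} (hs : IsMatching s)
    (ht : IsMatching t) {R : Finset α} {C : Finset β} (hsC : SplitsAt s R C)
    (htC : SplitsAt t R C) : IsMatching (RandomAssignment.replaceOn s t R) :=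
  hs.replaceOn ht (fun p hp => mt (hsC p hp).2) fun p hp => (htC p hp).1

theorem sum_replaceOn {M : Type*} [AddCommMonoid M] (s t : Finset (α × β)) (R : Finset α)
    (f : α × β → M) :
    ∑ p ∈ replaceOn s t R, f p = ∑ p ∈ s with p.1 ∉ R, f p + ∑ p ∈ t with p.1 ∈ R, f p :=
  Finset.sum_disjUnion _

theorem card_replaceOn (s t : Finset (α × β)) (R : Finset α) :
    (replaceOn s t R).card = {p ∈ s | p.1 ∉ R}.card + {p ∈ t | p.1 ∈ R}.card :=
  Finset.card_disjUnion _ _ _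

section AltCols

variable [DecidableEq β]

/-- The columns on the alternating path of `s` and `t` that leaves the row `u` along `s`. -/
noncomputable def altCols (s t : Finset (α × β)) (u : α) : Finset β :=
  {p ∈ s | p.1 ∈ altRows s t u}.image Prod.snd

theorem mem_altCols {s t : Finset (α × β)} {u : α} {b : β} :
    b ∈ altCols s t u ↔ ∃ p ∈ s, p.1 ∈ altRows s t u ∧ p.2 = b := by
  simp only [altCols, Finset.mem_image, Finset.mem_filter, and_assoc]

theorem splitsAt_altRows_altCols_left {s : Finset (α × β)} (hs : IsMatching s)
    (t : Finset (α × β)) (u : α) : SplitsAt s (altRows s t u) (altCols s t u) := by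
  refine fun p hp => ⟨fun h => mem_altCols.2 ⟨p, hp, h, rfl⟩, fun h => ?_⟩
  obtain ⟨q, hq, hqR, hqp⟩ := mem_altCols.1 h
  exact hs.eq_of_snd hq hp hqp ▸ hqR

theorem splitsAt_altRows_altCols_right (s : Finset (α × β)) {t : Finset (α × β)}
    (ht : IsMatching t) {u : α} (hu : ∀ p ∈ t, p.1 ≠ u) :
    SplitsAt t (altRows s t u) (altCols s t u) := by
  refine fun p hp => ⟨fun h => ?_, fun h => ?_⟩
  · obtain ⟨i, hi, b, hib, hpb⟩ := exists_mem_of_mem_altRows h (hu p hp)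
    have hbp : (p.1, b) = p := ht.eq_of_fst hpb hp rfl
    exact mem_altCols.2 ⟨(i, b), hib, hi, by rw [← hbp]⟩
  · obtain ⟨q, hq, hqR, hqp⟩ := mem_altCols.1 h
    exact mem_altRows.2 ((mem_altRows.1 hqR).tail ⟨p.2, hqp ▸ hq, hp⟩)

end AltCols

theorem card_filter_altRows_right_le (s : Finset (α × β)) {t : Finset (α × β)}
    (ht : IsMatching t) {u : α} (hu : ∀ p ∈ t, p.1 ≠ u) :
    {p ∈ t | p.1 ∈ altRows s t u}.card ≤ {p ∈ s | p.1 ∈ altRows s t u}.card := by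
  classical
  refine (Finset.card_le_card_of_injOn Prod.snd (t := altCols s t u) (fun p hp => ?_)
    (ht.subset (Finset.filter_subset _ _)).cols).trans Finset.card_image_le
  obtain ⟨hp, hpR⟩ := Finset.mem_filter.1 hp
  exact (splitsAt_altRows_altCols_right s ht hu p hp).1 hpR

theorem exists_splitsAt_of_forall_fst_ne {s t : Finset (α × β)} (hs : IsMatching s)
    (ht : IsMatching t) {u : α} (hu : ∀ p ∈ t, p.1 ≠ u) :
    ∃ (R : Finset α) (C : Finset β), u ∈ R ∧ SplitsAt s R C ∧ SplitsAt t R C ∧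
      {p ∈ t | p.1 ∈ R}.card ≤ {p ∈ s | p.1 ∈ R}.card ∧
      {p ∈ s | p.1 ∈ R}.card ≤ {p ∈ t | p.1 ∈ R}.card + 1 := by
  classical
  exact ⟨altRows s t u, altCols s t u, self_mem_altRows s t u, splitsAt_altRows_altCols_left hs t u,
    splitsAt_altRows_altCols_right s ht hu, card_filter_altRows_right_le s ht hu,
    card_filter_altRows_le hs t u⟩

theorem exists_splitsAt_of_card_lt {s t : Finset (α × β)} (hs : IsMatching s) (ht : IsMatching t)
    (h : t.card < s.card) :
    ∃ (R : Finset α) (C : Finset β), SplitsAt s R C ∧ SplitsAt t R C ∧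
      {p ∈ s | p.1 ∈ R}.card = {p ∈ t | p.1 ∈ R}.card + 1 := by
  classical
  induction hn : s.card using Nat.strong_induction_on generalizing s t with
  | _ n ih =>
    obtain ⟨p, hp, hpt⟩ := hs.exists_fst_ne_of_card_lt h
    obtain ⟨R, C, hpR, hsR, htR, hge, hle⟩ := exists_splitsAt_of_forall_fst_ne hs ht hpt
    rcases hge.lt_or_eq with hlt | heq
    · exact ⟨R, C, hsR, htR, by omega⟩
    -- The path is balanced: remove it from both matchings.
    have hs_add := Finset.card_filter_add_card_filter_not (s := s) (fun q => q.1 ∈ R)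
    have ht_add := Finset.card_filter_add_card_filter_not (s := t) (fun q => q.1 ∈ R)
    have hpos : 0 < {q ∈ s | q.1 ∈ R}.card :=
      Finset.card_pos.2 ⟨p, Finset.mem_filter.2 ⟨hp, hpR⟩⟩
    obtain ⟨R', C', hsR', htR', hcard⟩ := ih _ (by omega)
      (hs.subset (Finset.filter_subset (fun q => q.1 ∉ R) s))
      (ht.subset (Finset.filter_subset (fun q => q.1 ∉ R) t)) (by omega) rfl
    have hsplit : ∀ w : Finset (α × β), SplitsAt w R C →
        SplitsAt {q ∈ w | q.1 ∉ R} R' C' → SplitsAt w (R' \ R) (C' \ C) := by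
      intro w hw hw' q hq
      have hR := hw q hq
      have hR' := fun hqR => hw' q (Finset.mem_filter.2 ⟨hq, hqR⟩)
      simp only [Finset.mem_sdiff]
      tauto
    refine ⟨R' \ R, C' \ C, hsplit s hsR hsR', hsplit t htR htR', ?_⟩
    simpa only [Finset.filter_filter, Finset.mem_sdiff, and_comm] using hcard

theorem exists_matching_covering_rows_cols [DecidableEq β] {G s t : Finset (α × β)} {P : Finset α}
    {Q : Finset β} (hs : IsMatching s) (ht : IsMatching t) (hsG : s ⊆ G) (htG : t ⊆ G)
    (hP : P ⊆ s.image Prod.fst) (hQ : Q ⊆ t.image Prod.snd) :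
    ∃ M ⊆ G, IsMatching M ∧ P ⊆ M.image Prod.fst ∧ Q ⊆ M.image Prod.snd := by
  induction P using Finset.induction_on with
  | empty => exact ⟨t, htG, ht, Finset.empty_subset _, hQ⟩
  | insert u P _ ih =>
    obtain ⟨huP, hP⟩ := Finset.insert_subset_iff.1 hP
    obtain ⟨M, hMG, hM, hMP, hMQ⟩ := ih hP
    by_cases huM : u ∈ M.image Prod.fst
    · exact ⟨M, hMG, hM, Finset.insert_subset huM hMP, hMQ⟩
    have hu : ∀ p ∈ M, p.1 ≠ u := fun p hp hpu => huM (Finset.mem_image.2 ⟨p, hp, hpu⟩)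
    set R := altRows s M u
    have hsC := splitsAt_altRows_altCols_left hs M u
    have hMC := splitsAt_altRows_altCols_right s hM hu
    have hrow : ∀ i ∈ s.image Prod.fst, (i ∉ R → i ∈ M.image Prod.fst) →
        i ∈ (replaceOn M s R).image Prod.fst := by
      intro i his hiM
      simp only [Finset.mem_image, mem_replaceOn] at his hiM ⊢
      grind
    refine ⟨replaceOn M s R, fun p hp => ?_, ?_, Finset.insert_subset ?_ fun i hi => ?_,
      fun b hb => ?_⟩
    · rcases mem_replaceOn.1 hp with ⟨hp, -⟩ | ⟨hp, -⟩
      · exact hMG hp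
      · exact hsG hp
    · exact hM.replaceOn_of_splitsAt hs hMC hsC
    · exact hrow u huP fun huR => absurd (self_mem_altRows s M u) huR
    · exact hrow i (hP hi) fun _ => hMP hi
    · -- A column of the path that `M` uses is used by `s` on the path.
      obtain ⟨p, hp, rfl⟩ := Finset.mem_image.1 (hMQ hb)
      refine Finset.mem_image.2 ?_
      by_cases hpR : p.1 ∈ R
      · obtain ⟨q, hq, hqR, hqp⟩ := mem_altCols.1 ((hMC p hp).1 hpR)
        exact ⟨q, mem_replaceOn.2 (.inr ⟨hq, hqR⟩), hqp⟩
      · exact ⟨p, mem_replaceOn.2 (.inl ⟨hp, hpR⟩), rfl⟩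

end Matchings

section Duality

open Filter Topology

variable {α β : Type*}

theorem exists_pos_forall_le_of_pos {ι : Type*} [Finite ι] (f : ι → ℝ) :
    ∃ ε > 0, ∀ i, 0 < f i → ε ≤ f i := by
  have hev : ∀ᶠ ε in 𝓝[>] (0 : ℝ), ∀ i, 0 < f i → ε ≤ f i := by
    refine eventually_all.2 fun i => ?_
    by_cases hi : 0 < f i
    · exact (eventually_nhdsWithin_of_eventually_nhds (eventually_le_nhds hi)).mono
        fun ε hε _ => hε
    · exact .of_forall fun ε h => absurd h hi
  obtain ⟨ε, hε, hpos⟩ := (hev.and self_mem_nhdsWithin).exists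
  exact ⟨ε, hpos, hε⟩

theorem sum_comp_eq_sum_univ {ι κ : Type*} [Fintype κ] [DecidableEq κ] {s : Finset ι}
    {g : ι → κ} (hg : Set.InjOn g s) {y : κ → ℝ} (hy : ∀ i, 0 ≤ y i)
    (hs : ∀ i, 0 < y i → i ∈ s.image g) : ∑ p ∈ s, y (g p) = ∑ i, y i := by
  rw [← Finset.sum_image (f := y) hg]
  exact Finset.sum_subset (Finset.subset_univ _) fun i _ hi =>
    (hy i).eq_of_not_lt' fun hlt => hi (hs i hlt)

theorem sum_comp_le_sum_univ {ι κ : Type*} [Fintype κ] {s : Finset ι} {g : ι → κ}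
    (hg : Set.InjOn g s) {y : κ → ℝ} (hy : ∀ i, 0 ≤ y i) : ∑ p ∈ s, y (g p) ≤ ∑ i, y i := by
  classical
  rw [← Finset.sum_image (f := y) hg]
  exact Finset.sum_le_sum_of_subset_of_nonneg (Finset.subset_univ _) fun i _ _ => hy i

theorem exists_mem_eq_of_sum_univ_le {ι κ : Type*} [Fintype κ] {s : Finset ι} {g : ι → κ}
    (hg : Set.InjOn g s) {y : κ → ℝ} (hy : ∀ i, 0 ≤ y i) (hle : ∑ i, y i ≤ ∑ p ∈ s, y (g p))
    {i : κ} (hi : 0 < y i) : ∃ p ∈ s, g p = i := by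
  classical
  rw [← Finset.sum_image (f := y) hg] at hle
  by_contra! hne
  refine hle.not_gt (Finset.sum_lt_sum_of_subset (Finset.subset_univ _) (Finset.mem_univ i) ?_ hi
    fun j _ _ => hy j)
  simpa only [Finset.mem_image, not_exists, not_and] using hne

/-- `y` and `z` are nonnegative potentials that dominate the weights `w`: the feasible solutions
of the linear program dual to finding a matching of maximal weight. -/
structure IsWeightCover (w : α → β → ℝ) (y : α → ℝ) (z : β → ℝ) : Prop where
  row_nonneg : ∀ i, 0 ≤ y i
  col_nonneg : ∀ b, 0 ≤ z b
  le_add : ∀ i b, w i b ≤ y i + z b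

theorem IsWeightCover.swap {w : α → β → ℝ} {y : α → ℝ} {z : β → ℝ} (h : IsWeightCover w y z) :
    IsWeightCover (fun b i => w i b) z y :=
  ⟨h.col_nonneg, h.row_nonneg, fun b i => (h.le_add i b).trans_eq (add_comm _ _)⟩

theorem exists_isWeightCover [Finite β] (w : α → β → ℝ) : ∃ y z, IsWeightCover w y z := by
  cases nonempty_fintype β
  exact ⟨fun i => ∑ b, |w i b|, fun _ => 0, fun i => Finset.sum_nonneg fun b _ => abs_nonneg _,
    fun _ => le_rfl, fun i b => by
      rw [add_zero]
      exact (le_abs_self _).trans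
        (Finset.single_le_sum (f := fun b => |w i b|) (fun b _ => abs_nonneg _)
          (Finset.mem_univ b))⟩

section Fintype

variable [Fintype α] [Fintype β]

theorem isCompact_setOf_isWeightCover (w : α → β → ℝ) (S : ℝ) :
    IsCompact {q : (α → ℝ) × (β → ℝ) |
      IsWeightCover w q.1 q.2 ∧ ∑ i, q.1 i + ∑ b, q.2 b ≤ S} := by
  have hset : {q : (α → ℝ) × (β → ℝ) |
      IsWeightCover w q.1 q.2 ∧ ∑ i, q.1 i + ∑ b, q.2 b ≤ S} =
      Set.Ici 0 ∩ ((⋂ i, ⋂ b, {q | w i b ≤ q.1 i + q.2 b}) ∩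
        {q | ∑ i, q.1 i + ∑ b, q.2 b ≤ S}) := by
    ext q
    simp only [Set.mem_inter_iff, Set.mem_iInter]
    exact ⟨fun h => ⟨⟨h.1.row_nonneg, h.1.col_nonneg⟩, h.1.le_add, h.2⟩,
      fun h => ⟨⟨h.1.1, h.1.2, h.2.1⟩, h.2.2⟩⟩
  refine isCompact_Icc (a := (0, 0)) (b := (fun _ => S, fun _ => S)) |>.of_isClosed_subset ?_ ?_
  · rw [hset]
    exact isClosed_Ici.inter <| (isClosed_iInter fun i => isClosed_iInter fun b =>
      isClosed_le continuous_const (by fun_prop)).inter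
        (isClosed_le (by fun_prop) continuous_const)
  · rintro ⟨y, z⟩ ⟨h, hle⟩
    dsimp only at h hle
    have hy := Finset.sum_nonneg fun i (_ : i ∈ Finset.univ) => h.row_nonneg i
    have hz := Finset.sum_nonneg fun b (_ : b ∈ Finset.univ) => h.col_nonneg b
    refine ⟨⟨h.row_nonneg, h.col_nonneg⟩, fun i => ?_, fun b => ?_⟩
    · exact (Finset.single_le_sum (fun i _ => h.row_nonneg i) (Finset.mem_univ i)).trans
        (by linarith)
    · exact (Finset.single_le_sum (fun b _ => h.col_nonneg b) (Finset.mem_univ b)).trans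
        (by linarith)

/-- A feasible solution of the dual program with minimal total weight. -/
structure IsMinWeightCover (w : α → β → ℝ) (y : α → ℝ) (z : β → ℝ) : Prop
    extends IsWeightCover w y z where
  sum_le : ∀ y' z', IsWeightCover w y' z' →
    ∑ i, y i + ∑ b, z b ≤ ∑ i, y' i + ∑ b, z' b

theorem IsMinWeightCover.swap {w : α → β → ℝ} {y : α → ℝ} {z : β → ℝ}
    (h : IsMinWeightCover w y z) : IsMinWeightCover (fun b i => w i b) z y :=
  ⟨h.toIsWeightCover.swap, fun z' y' h' => by linarith [h.sum_le y' z' h'.swap]⟩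

theorem exists_isMinWeightCover (w : α → β → ℝ) : ∃ y z, IsMinWeightCover w y z := by
  obtain ⟨y₀, z₀, h₀⟩ := exists_isWeightCover w
  obtain ⟨⟨y, z⟩, hyz, hmin⟩ :=
    (isCompact_setOf_isWeightCover w (∑ i, y₀ i + ∑ b, z₀ b)).exists_isMinOn ⟨(y₀, z₀), h₀, le_rfl⟩
      (f := fun q => ∑ i, q.1 i + ∑ b, q.2 b) (by fun_prop)
  refine ⟨y, z, hyz.1, fun y' z' h' => ?_⟩
  by_cases hle : ∑ i, y' i + ∑ b, z' b ≤ ∑ i, y₀ i + ∑ b, z₀ b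
  · exact hmin (a := (y', z')) ⟨h', hle⟩
  · exact hyz.2.trans (not_le.1 hle).le

theorem IsWeightCover.sum_le {w : α → β → ℝ} {y : α → ℝ} {z : β → ℝ} (h : IsWeightCover w y z)
    {s : Finset (α × β)} (hs : IsMatching s) :
    ∑ p ∈ s, w p.1 p.2 ≤ ∑ i, y i + ∑ b, z b :=
  calc ∑ p ∈ s, w p.1 p.2 ≤ ∑ p ∈ s, (y p.1 + z p.2) :=
        Finset.sum_le_sum fun p _ => h.le_add p.1 p.2
    _ = ∑ p ∈ s, y p.1 + ∑ p ∈ s, z p.2 := Finset.sum_add_distrib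
    _ ≤ ∑ i, y i + ∑ b, z b :=
        add_le_add (sum_comp_le_sum_univ hs.rows h.row_nonneg)
          (sum_comp_le_sum_univ hs.cols h.col_nonneg)

theorem IsWeightCover.complementary_slackness {w : α → β → ℝ} {y : α → ℝ} {z : β → ℝ}
    (h : IsWeightCover w y z) {s : Finset (α × β)} (hs : IsMatching s)
    (heq : ∑ p ∈ s, w p.1 p.2 = ∑ i, y i + ∑ b, z b) :
    (∀ p ∈ s, w p.1 p.2 = y p.1 + z p.2) ∧ (∀ i, 0 < y i → ∃ p ∈ s, p.1 = i) ∧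
      ∀ b, 0 < z b → ∃ p ∈ s, p.2 = b := by
  have hw : ∑ p ∈ s, w p.1 p.2 ≤ ∑ p ∈ s, (y p.1 + z p.2) :=
    Finset.sum_le_sum fun p _ => h.le_add p.1 p.2
  have hadd : ∑ p ∈ s, (y p.1 + z p.2) = ∑ p ∈ s, y p.1 + ∑ p ∈ s, z p.2 :=
    Finset.sum_add_distrib
  have hy := sum_comp_le_sum_univ hs.rows h.row_nonneg
  have hz := sum_comp_le_sum_univ hs.cols h.col_nonneg
  exact ⟨(Finset.sum_eq_sum_iff_of_le fun p _ => h.le_add p.1 p.2).1 (by linarith),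
    fun i => exists_mem_eq_of_sum_univ_le hs.rows h.row_nonneg (by linarith),
    fun b => exists_mem_eq_of_sum_univ_le hs.cols h.col_nonneg (by linarith)⟩

end Fintype

theorem IsMatching.swap [DecidableEq α] [DecidableEq β] {s : Finset (α × β)} (hs : IsMatching s) :
    IsMatching (s.image Prod.swap) := by
  constructor <;> rw [Finset.coe_image]
  exacts [Set.InjOn.image_of_comp hs.cols, Set.InjOn.image_of_comp hs.rows]

theorem IsWeightCover.shift [DecidableEq α] [DecidableEq β] {w : α → β → ℝ} {y : α → ℝ}
    {z : β → ℝ} (h : IsWeightCover w y z) {ε : ℝ} (hε : 0 ≤ ε) {X : Finset α} {N : Finset β}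
    (hX : ∀ i ∈ X, ε ≤ y i) (hN : ∀ i ∈ X, ∀ b ∉ N, ε ≤ y i + z b - w i b) :
    IsWeightCover w (fun i => y i - if i ∈ X then ε else 0)
      (fun b => z b + if b ∈ N then ε else 0) := by
  refine ⟨fun i => ?_, fun b => ?_, fun i b => ?_⟩
  · have := h.row_nonneg i
    have := hX i
    split_ifs with hi <;> grind
  · have := h.col_nonneg b
    split_ifs <;> linarith
  · have := h.le_add i b
    have := hN i
    split_ifs <;> grind

variable [Fintype α] [Fintype β]

/-- Otherwise lowering `y` on `X` and raising `z` on the tight columns would lower the total. -/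
theorem IsMinWeightCover.card_le_card_tight {w : α → β → ℝ} {y : α → ℝ} {z : β → ℝ}
    (h : IsMinWeightCover w y z) {X : Finset α} (hX : ∀ i ∈ X, 0 < y i) :
    X.card ≤ ({b | ∃ i ∈ X, w i b = y i + z b} : Finset β).card := by
  classical
  set N : Finset β := {b | ∃ i ∈ X, w i b = y i + z b}
  obtain ⟨ε₁, hε₁, hy⟩ := exists_pos_forall_le_of_pos y
  obtain ⟨ε₂, hε₂, hgap⟩ :=
    exists_pos_forall_le_of_pos fun p : α × β => y p.1 + z p.2 - w p.1 p.2
  set ε := min ε₁ ε₂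
  have hε : 0 < ε := lt_min hε₁ hε₂
  have hsum := h.sum_le _ _ <| h.shift (N := N) hε.le
    (fun i hi => (min_le_left _ _).trans (hy i (hX i hi))) fun i hi b hb => by
      have hne : w i b ≠ y i + z b := fun heq =>
        hb (Finset.mem_filter.2 ⟨Finset.mem_univ b, i, hi, heq⟩)
      exact (min_le_right _ _).trans
        (hgap (i, b) (sub_pos.2 (lt_of_le_of_ne (h.le_add i b) hne)))
  simp only [Finset.sum_sub_distrib, Finset.sum_add_distrib, Finset.sum_ite_mem,
    Finset.univ_inter, Finset.sum_const, nsmul_eq_mul] at hsum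
  have hmul : (X.card : ℝ) * ε ≤ N.card * ε := by linarith
  exact_mod_cast le_of_mul_le_mul_right hmul hε

theorem IsMinWeightCover.exists_tight_matching [DecidableEq α] {w : α → β → ℝ} {y : α → ℝ}
    {z : β → ℝ} (h : IsMinWeightCover w y z) :
    ∃ s : Finset (α × β), IsMatching s ∧ (∀ p ∈ s, w p.1 p.2 = y p.1 + z p.2) ∧
      ({i | 0 < y i} : Finset α) ⊆ s.image Prod.fst := by
  classical
  let N : {i // 0 < y i} → Finset β := fun i => {b | w i b = y i + z b}
  have hall : ∀ X : Finset {i // 0 < y i}, X.card ≤ (X.biUnion N).card := by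
    intro X
    have hX := h.card_le_card_tight (X := X.map (Function.Embedding.subtype _))
      (by simp only [Finset.mem_map]; rintro _ ⟨i, -, rfl⟩; exact i.2)
    rw [Finset.card_map] at hX
    refine hX.trans (Finset.card_le_card fun b hb => ?_)
    simpa [N] using hb
  obtain ⟨f, hf, hfN⟩ := (Finset.all_card_le_biUnion_card_iff_exists_injective N).1 hall
  refine ⟨Finset.univ.image fun i : {i // 0 < y i} => (i.1, f i), ⟨?_, ?_⟩, ?_, fun i hi => ?_⟩
  · rw [Finset.coe_image]
    exact Set.InjOn.image_of_comp Subtype.val_injective.injOn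
  · rw [Finset.coe_image]
    exact Set.InjOn.image_of_comp hf.injOn
  · intro p hp
    obtain ⟨i, -, rfl⟩ := Finset.mem_image.1 hp
    exact (Finset.mem_filter.1 (hfN i)).2
  · have hi : 0 < y i := (Finset.mem_filter.1 hi).2
    exact Finset.mem_image.2 ⟨_, Finset.mem_image_of_mem _ (Finset.mem_univ ⟨i, hi⟩), rfl⟩

/-- **Egerváry's theorem**: the maximal weight of a matching is the minimal total weight of a
cover. -/
theorem exists_weightCover_eq_matching (w : α → β → ℝ) :
    ∃ (y : α → ℝ) (z : β → ℝ) (M : Finset (α × β)), IsWeightCover w y z ∧ IsMatching M ∧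
      ∑ i, y i + ∑ b, z b = ∑ p ∈ M, w p.1 p.2 := by
  classical
  obtain ⟨y, z, h⟩ := exists_isMinWeightCover w
  obtain ⟨s, hs, hs_tight, hy⟩ := h.exists_tight_matching
  obtain ⟨t, ht, ht_tight, hz⟩ := h.swap.exists_tight_matching
  obtain ⟨M, hM_tight, hM, hMy, hMz⟩ := exists_matching_covering_rows_cols
    (G := {p | w p.1 p.2 = y p.1 + z p.2}) hs ht.swap (fun p hp => by simpa using hs_tight p hp)
    (fun p hp => by
      obtain ⟨q, hq, rfl⟩ := Finset.mem_image.1 hp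
      simpa [add_comm] using ht_tight q hq)
    hy (hz.trans_eq (by rw [Finset.image_image]; rfl))
  refine ⟨y, z, M, h.toIsWeightCover, hM, ?_⟩
  have hrows : ∑ p ∈ M, y p.1 = ∑ i, y i :=
    sum_comp_eq_sum_univ hM.rows h.row_nonneg fun i hi => hMy (by simpa using hi)
  have hcols : ∑ p ∈ M, z p.2 = ∑ b, z b :=
    sum_comp_eq_sum_univ hM.cols h.col_nonneg fun b hb => hMz (by simpa using hb)
  rw [← hrows, ← hcols, ← Finset.sum_add_distrib]
  exact Finset.sum_congr rfl fun p hp => by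
    simpa using (Finset.mem_filter.1 (hM_tight hp)).2.symm

end Duality

section Optimal

variable {m n : ℕ} {A : Fin m → Fin n → ℝ} {Z s t : Finset (Fin m × Fin n)} {j k : ℕ}

theorem IsAssignment.isMatching (h : IsAssignment k s) : IsMatching s := ⟨h.rows, h.cols⟩

theorem IsMatching.isAssignment (h : IsMatching s) (hk : s.card = k) : IsAssignment k s :=
  ⟨hk, h.rows, h.cols⟩

theorem IsAssignment.le_min (h : IsAssignment k s) : k ≤ min m n := by
  rw [← h.card_eq, le_min_iff]
  constructor
  · simpa using Finset.card_le_card_of_injOn (t := Finset.univ) Prod.fst (by simp) h.rows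
  · simpa using Finset.card_le_card_of_injOn (t := Finset.univ) Prod.snd (by simp) h.cols

theorem IsAssignment.erase (h : IsAssignment (k + 1) s) {p : Fin m × Fin n} (hp : p ∈ s) :
    IsAssignment k (s.erase p) :=
  (h.isMatching.subset (Finset.erase_subset _ _)).isAssignment
    (by rw [Finset.card_erase_of_mem hp, h.card_eq, Nat.add_sub_cancel])

theorem IsAssignment.exists_subset (h : IsAssignment k s) (hj : j ≤ k) :
    ∃ t ⊆ s, IsAssignment j t := by
  obtain ⟨t, hts, ht⟩ := Finset.exists_subset_card_eq (hj.trans_eq h.card_eq.symm)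
  exact ⟨t, hts, (h.isMatching.subset hts).isAssignment ht⟩

theorem exists_isAssignment (hk : k ≤ min m n) :
    ∃ s : Finset (Fin m × Fin n), IsAssignment k s := by
  have hm := Fin.castLE_injective (hk.trans (min_le_left m n))
  have hn := Fin.castLE_injective (hk.trans (min_le_right m n))
  refine ⟨Finset.univ.image fun i : Fin k => (Fin.castLE (hk.trans (min_le_left m n)) i,
    Fin.castLE (hk.trans (min_le_right m n)) i), ?_, ?_, ?_⟩
  · rw [Finset.card_image_of_injective _ fun _ _ h => hm (congrArg Prod.fst h),
      Finset.card_univ, Fintype.card_fin]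
  · rw [Finset.coe_image]
    exact Set.InjOn.image_of_comp hm.injOn
  · rw [Finset.coe_image]
    exact Set.InjOn.image_of_comp hn.injOn

theorem exists_isOptimal (A : Fin m → Fin n → ℝ) (hk : k ≤ min m n) :
    ∃ s, IsOptimal A k s := by
  obtain ⟨s, hs⟩ := exists_isAssignment hk
  exact Set.exists_min_image {s | IsAssignment k s} (cost A) (Set.toFinite _) ⟨s, hs⟩

/-- The minimal cost of a `k`-assignment, with the junk value `0` if there is none. -/
noncomputable def optValue (A : Fin m → Fin n → ℝ) (k : ℕ) : ℝ :=
  ⨅ s : {s : Finset (Fin m × Fin n) // IsAssignment k s}, cost A s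

theorem IsAssignment.optValue_le (h : IsAssignment k s) : optValue A k ≤ cost A s :=
  ciInf_le (Set.finite_range _).bddBelow (⟨s, h⟩ : {s : Finset (Fin m × Fin n) // IsAssignment k s})

theorem IsOptimal.cost_eq (h : IsOptimal A k s) : cost A s = optValue A k :=
  have : Nonempty {s : Finset (Fin m × Fin n) // IsAssignment k s} := ⟨⟨s, h.1⟩⟩
  le_antisymm (le_ciInf fun t => h.2 t t.2) h.1.optValue_le

theorem IsAssignment.isOptimal (h : IsAssignment k s) (hc : cost A s ≤ optValue A k) :
    IsOptimal A k s :=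
  ⟨h, fun _ ht => hc.trans ht.optValue_le⟩

theorem cost_erase {p : Fin m × Fin n} (hp : p ∈ s) :
    cost A (s.erase p) + A p.1 p.2 = cost A s :=
  Finset.sum_erase_add (f := fun p => A p.1 p.2) s hp

theorem cost_replaceOn_add (A : Fin m → Fin n → ℝ) (s t : Finset (Fin m × Fin n))
    (R : Finset (Fin m)) :
    cost A (replaceOn s t R) + cost A (replaceOn t s R) = cost A s + cost A t := by
  simp only [cost, sum_replaceOn]
  have hs := Finset.sum_filter_add_sum_filter_not s (fun p => p.1 ∈ R) fun p => A p.1 p.2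
  have ht := Finset.sum_filter_add_sum_filter_not t (fun p => p.1 ∈ R) fun p => A p.1 p.2
  linarith

/-- `Z` does not contain a `k`-assignment: then an optimal `k`-assignment of a matrix that is
positive outside `Z` has positive cost. -/
def NoZeroAssignment (Z : Finset (Fin m × Fin n)) (k : ℕ) : Prop :=
  ∀ s, IsAssignment k s → ¬ s ⊆ Z

theorem NoZeroAssignment.mono (h : NoZeroAssignment Z j) (hjk : j ≤ k) :
    NoZeroAssignment Z k := fun _ hs hsZ =>
  let ⟨t, hts, ht⟩ := hs.exists_subset hjk
  h t ht (hts.trans hsZ)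

/-- A matrix that vanishes on `Z` and is positive elsewhere, and in which distinct sets of positions
outside `Z` have distinct costs. -/
structure IsGeneric (Z : Finset (Fin m × Fin n)) (A : Fin m → Fin n → ℝ) : Prop where
  zero : ∀ p ∈ Z, A p.1 p.2 = 0
  pos : ∀ p ∉ Z, 0 < A p.1 p.2
  cost_inj : ∀ s t : Finset (Fin m × Fin n), Disjoint s Z → Disjoint t Z →
    cost A s = cost A t → s = t

theorem IsGeneric.nonneg (hA : IsGeneric Z A) (p : Fin m × Fin n) : 0 ≤ A p.1 p.2 := by
  by_cases hp : p ∈ Z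
  · exact (hA.zero p hp).ge
  · exact (hA.pos p hp).le

theorem IsGeneric.cost_mono (hA : IsGeneric Z A) (h : s ⊆ t) : cost A s ≤ cost A t :=
  Finset.sum_le_sum_of_subset_of_nonneg h fun p _ _ => hA.nonneg p

theorem IsGeneric.cost_sdiff (hA : IsGeneric Z A) (s : Finset (Fin m × Fin n)) :
    cost A (s \ Z) = cost A s :=
  Finset.sum_subset Finset.sdiff_subset fun p hp hp' => hA.zero p (by simpa [hp] using hp')

theorem IsGeneric.mem_of_isOptimal (hA : IsGeneric Z A) (hs : IsOptimal A k s)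
    (ht : IsOptimal A k t) {p : Fin m × Fin n} (hp : p ∈ s) (hpZ : p ∉ Z) : p ∈ t := by
  have heq : s \ Z = t \ Z := hA.cost_inj _ _ Finset.sdiff_disjoint Finset.sdiff_disjoint
    (by rw [hA.cost_sdiff, hA.cost_sdiff, hs.cost_eq, ht.cost_eq])
  exact (Finset.mem_sdiff.1 (heq ▸ Finset.mem_sdiff.2 ⟨hp, hpZ⟩)).1

theorem IsGeneric.optValue_lt_succ (hA : IsGeneric Z A) (hk : k + 1 ≤ min m n)
    (hZ : NoZeroAssignment Z (k + 1)) : optValue A k < optValue A (k + 1) := by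
  obtain ⟨s, hs⟩ := exists_isOptimal A hk
  obtain ⟨p, hp, hpZ⟩ := Finset.not_subset.1 (hZ s hs.1)
  rw [← hs.cost_eq, ← cost_erase hp]
  exact (hs.1.erase hp).optValue_le.trans_lt (lt_add_of_pos_right _ (hA.pos p hpZ))

section Convexity

theorem IsAssignment.exists_balanced_replaceOn (hs : IsAssignment (j + 2) s)
    (ht : IsAssignment j t) : ∃ R : Finset (Fin m), IsAssignment (j + 1) (replaceOn s t R) ∧
      IsAssignment (j + 1) (replaceOn t s R) := by
  obtain ⟨R, C, hsC, htC, hcard⟩ := exists_splitsAt_of_card_lt hs.isMatching ht.isMatching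
    (by rw [hs.card_eq, ht.card_eq]; omega)
  have hs_add := Finset.card_filter_add_card_filter_not (s := s) (fun p => p.1 ∈ R)
  have ht_add := Finset.card_filter_add_card_filter_not (s := t) (fun p => p.1 ∈ R)
  rw [hs.card_eq] at hs_add
  rw [ht.card_eq] at ht_add
  exact ⟨R, (hs.isMatching.replaceOn_of_splitsAt ht.isMatching hsC htC).isAssignment
      (by rw [card_replaceOn]; omega),
    (ht.isMatching.replaceOn_of_splitsAt hs.isMatching htC hsC).isAssignment
      (by rw [card_replaceOn]; omega)⟩

theorem optValue_convex (A : Fin m → Fin n → ℝ) (hj : j + 2 ≤ min m n) :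
    optValue A (j + 1) - optValue A j ≤ optValue A (j + 2) - optValue A (j + 1) := by
  obtain ⟨s, hs⟩ := exists_isOptimal A hj
  obtain ⟨t, ht⟩ := exists_isOptimal A (show j ≤ min m n by omega)
  obtain ⟨R, hR, hR'⟩ := hs.1.exists_balanced_replaceOn ht.1
  have hcost := cost_replaceOn_add A s t R
  rw [hs.cost_eq, ht.cost_eq] at hcost
  linarith [hR.optValue_le (A := A), hR'.optValue_le (A := A)]

/-- If both exchanges of `s` and `t` are optimal, they contain the same positions outside `Z`, so
every such position of `s` lies in `t`. -/
theorem IsGeneric.sdiff_subset_of_isOptimal_replaceOn (hA : IsGeneric Z A) {R : Finset (Fin m)}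
    (h : IsOptimal A k (replaceOn s t R)) (h' : IsOptimal A k (replaceOn t s R)) :
    s \ Z ⊆ t := by
  intro p hp
  obtain ⟨hp, hpZ⟩ := Finset.mem_sdiff.1 hp
  by_cases hR : p.1 ∈ R
  · have hmem := hA.mem_of_isOptimal h' h (mem_replaceOn.2 (.inr ⟨hp, hR⟩)) hpZ
    simpa [mem_replaceOn, hR] using hmem
  · have hmem := hA.mem_of_isOptimal h h' (mem_replaceOn.2 (.inl ⟨hp, hR⟩)) hpZ
    simpa [mem_replaceOn, hR] using hmem

theorem IsGeneric.optValue_strict_convex (hA : IsGeneric Z A) (hj : j + 2 ≤ min m n)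
    (hZ : NoZeroAssignment Z (j + 2)) :
    optValue A (j + 1) - optValue A j < optValue A (j + 2) - optValue A (j + 1) := by
  refine (optValue_convex A hj).lt_of_ne fun heq => ?_
  obtain ⟨s, hs⟩ := exists_isOptimal A hj
  obtain ⟨t, ht⟩ := exists_isOptimal A (show j ≤ min m n by omega)
  obtain ⟨R, hR, hR'⟩ := hs.1.exists_balanced_replaceOn ht.1
  have hcost := cost_replaceOn_add A s t R
  rw [hs.cost_eq, ht.cost_eq] at hcost
  have hle := hR.optValue_le (A := A)
  have hle' := hR'.optValue_le (A := A)
  have hsub : s \ Z ⊆ t := hA.sdiff_subset_of_isOptimal_replaceOn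
    (hR.isOptimal (by linarith)) (hR'.isOptimal (by linarith))
  have hst : optValue A (j + 2) ≤ optValue A j := by
    rw [← hs.cost_eq, ← ht.cost_eq, ← hA.cost_sdiff s]
    exact hA.cost_mono hsub
  have hlt : optValue A (j + 1) < optValue A (j + 2) := hA.optValue_lt_succ hj hZ
  linarith

theorem monotoneOn_optValue_increment (A : Fin m → Fin n → ℝ) :
    MonotoneOn (fun l => optValue A (l + 1) - optValue A l) (Set.Iio (min m n)) :=
  monotoneOn_of_le_add_one Set.ordConnected_Iio fun _ _ _ hl =>
    optValue_convex A (Nat.succ_le_of_lt hl)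

theorem lt_sub_mul_of_increment_lt {v : ℕ → ℝ} {c : ℝ} {N : ℕ} (hj : v (j + 1) - v j = c)
    (hlow : ∀ l < j, v (l + 1) - v l < c) (hhigh : ∀ l, j < l → l < N → c < v (l + 1) - v l)
    {l : ℕ} (hl : l ≤ N) (hne : l ≠ j) (hne' : l ≠ j + 1) : v j - j * c < v l - l * c := by
  have hanti : StrictAntiOn (fun l : ℕ => v l - l * c) (Set.Iic j) :=
    strictAntiOn_of_add_one_lt Set.ordConnected_Iic fun _ _ _ hl => by
      push_cast
      linarith [hlow _ (Nat.lt_of_succ_le hl)]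
  have hmono : StrictMonoOn (fun l : ℕ => v l - l * c) (Set.Icc (j + 1) N) :=
    strictMonoOn_of_lt_add_one Set.ordConnected_Icc fun _ _ hl hl' => by
      push_cast
      linarith [hhigh _ hl.1 (Nat.lt_of_succ_le hl'.2)]
  rcases hne.lt_or_gt with hlt | hgt
  · exact hanti hlt.le (le_refl j) hlt
  · have hgt' : j + 1 < l := lt_of_le_of_ne hgt hne'.symm
    have hlt := hmono ⟨le_rfl, hgt'.le.trans hl⟩ ⟨hgt'.le, hl⟩ hgt'
    push_cast at hlt
    linarith

theorem IsGeneric.optValue_lt_sub_mul (hA : IsGeneric Z A) (hj : j + 1 ≤ min m n)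
    (hZ : NoZeroAssignment Z (j + 1)) {l : ℕ} (hl : l ≤ min m n) (hne : l ≠ j)
    (hne' : l ≠ j + 1) :
    optValue A j - j * (optValue A (j + 1) - optValue A j) <
      optValue A l - l * (optValue A (j + 1) - optValue A j) := by
  have hmono := monotoneOn_optValue_increment A
  refine lt_sub_mul_of_increment_lt rfl (fun i hi => ?_) (fun i hi hi' => ?_) hl hne hne'
  · obtain ⟨j, rfl⟩ : ∃ j', j = j' + 1 := ⟨j - 1, by omega⟩
    exact (hmono (Set.mem_Iio.2 (by omega)) (Set.mem_Iio.2 (by omega)) (by omega)).trans_lt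
      (hA.optValue_strict_convex hj hZ)
  · exact (hA.optValue_strict_convex (by omega) (hZ.mono (by omega))).trans_le
      (hmono (Set.mem_Iio.2 (by omega)) (Set.mem_Iio.2 hi') (Nat.succ_le_of_lt hi))

end Convexity

section CommonRows

open scoped Classical in
/-- The rows that are used by every optimal `k`-assignment. -/
noncomputable def commonRows (A : Fin m → Fin n → ℝ) (k : ℕ) : Finset (Fin m) :=
  {i | ∀ s, IsOptimal A k s → UsesRow s i}

theorem mem_commonRows {i : Fin m} :
    i ∈ commonRows A k ↔ ∀ s, IsOptimal A k s → UsesRow s i := by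
  simp [commonRows]

theorem usesRow_iff {i : Fin m} : UsesRow s i ↔ ∃ p ∈ s, p.1 = i :=
  ⟨fun ⟨_, h⟩ => ⟨_, h, rfl⟩, by rintro ⟨p, hp, rfl⟩; exact ⟨p.2, hp⟩⟩

theorem exists_mem_fst_eq_of_mem_commonRows (hs : IsOptimal A k s) {i : Fin m}
    (hi : i ∈ commonRows A k) : ∃ p ∈ s, p.1 = i :=
  usesRow_iff.1 (mem_commonRows.1 hi s hs)

theorem exists_isOptimal_forall_fst_ne {i : Fin m} (hi : i ∉ commonRows A k) :
    ∃ s, IsOptimal A k s ∧ ∀ p ∈ s, p.1 ≠ i := by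
  simp only [mem_commonRows, usesRow_iff] at hi
  push Not at hi
  exact hi

theorem IsGeneric.mem_commonRows_of_mem (hA : IsGeneric Z A) (hs : IsOptimal A k s)
    {p : Fin m × Fin n} (hp : p ∈ s) (hpZ : p ∉ Z) : p.1 ∈ commonRows A k :=
  mem_commonRows.2 fun _ ht => ⟨p.2, hA.mem_of_isOptimal hs ht hp hpZ⟩

/-- Exchange an optimal `(j + 1)`-assignment that avoids the row `f` along the alternating path from
`f`. Either the sizes are preserved, and there is an optimal `j`-assignment without `f`, or they
become `j - 1` and `j + 2`, contradicting strict convexity. -/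
theorem IsGeneric.commonRows_subset_succ (hA : IsGeneric Z A) (hj : j + 1 ≤ min m n)
    (hZ : NoZeroAssignment Z (j + 1)) : commonRows A j ⊆ commonRows A (j + 1) := by
  intro f hf
  by_contra hf'
  obtain ⟨t, ht, htf⟩ := exists_isOptimal_forall_fst_ne hf'
  obtain ⟨s, hs⟩ := exists_isOptimal A (show j ≤ min m n by omega)
  obtain ⟨R, C, hfR, hsC, htC, hge, hle⟩ :=
    exists_splitsAt_of_forall_fst_ne hs.1.isMatching ht.1.isMatching htf
  have hst := hs.1.isMatching.replaceOn_of_splitsAt ht.1.isMatching hsC htC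
  have hts := ht.1.isMatching.replaceOn_of_splitsAt hs.1.isMatching htC hsC
  have hs_add := Finset.card_filter_add_card_filter_not (s := s) (fun p => p.1 ∈ R)
  have ht_add := Finset.card_filter_add_card_filter_not (s := t) (fun p => p.1 ∈ R)
  rw [hs.1.card_eq] at hs_add
  rw [ht.1.card_eq] at ht_add
  have hst_card := card_replaceOn s t R
  have hts_card := card_replaceOn t s R
  have hcost := cost_replaceOn_add A s t R
  rw [hs.cost_eq, ht.cost_eq] at hcost
  rcases hge.lt_or_eq with hlt | heq
  · obtain ⟨i, rfl⟩ : ∃ i, j = i + 1 := ⟨j - 1, by omega⟩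
    have hst := hst.isAssignment (k := i) (by omega)
    have hts := hts.isAssignment (k := i + 3) (by omega)
    have hconvex := optValue_convex A (j := i + 1) hts.le_min
    have hstrict : _ < optValue A (i + 1 + 1) - _ := hA.optValue_strict_convex (j := i) hj hZ
    have hst_le := hst.optValue_le (A := A)
    have hts_le : optValue A (i + 1 + 2) ≤ _ := hts.optValue_le (A := A)
    linarith
  · have hst := hst.isAssignment (k := j) (by omega)
    have hts_le := (hts.isAssignment (k := j + 1) (by omega)).optValue_le (A := A)
    obtain ⟨p, hp, hpf⟩ :=
      exists_mem_fst_eq_of_mem_commonRows (hst.isOptimal (by linarith)) hf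
    rcases mem_replaceOn.1 hp with ⟨-, hpR⟩ | ⟨hpt, -⟩
    · exact hpR (hpf ▸ hfR)
    · exact htf p hpt hpf

end CommonRows

section Potential

/-- Dual variables that certify the optimal values for `j` and `j + 1` at the same time. -/
structure IsPotential (A : Fin m → Fin n → ℝ) (j : ℕ) (c : ℝ) (y : Fin m → ℝ) (z : Fin n → ℝ) :
    Prop extends IsWeightCover (fun i b => c - A i b) y z where
  pos : 0 < c
  value : j * c - (∑ i, y i + ∑ b, z b) = optValue A j
  value_succ : (j + 1 : ℕ) * c - (∑ i, y i + ∑ b, z b) = optValue A (j + 1)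
  row_pos : ∀ i ∈ commonRows A j, 0 < y i

theorem IsAssignment.sum_sub (hs : IsAssignment k s) (A : Fin m → Fin n → ℝ) (c : ℝ) :
    ∑ p ∈ s, (c - A p.1 p.2) = k * c - cost A s := by
  rw [Finset.sum_sub_distrib, Finset.sum_const, hs.card_eq, nsmul_eq_mul, cost]

theorem exists_pos_forall_add_mul_le {ι : Type*} [Finite ι] {v w : ι → ℝ} {v₀ w₀ : ℝ}
    (h : ∀ i, v₀ < v i ∨ v₀ = v i ∧ w₀ ≤ w i) : ∃ ε > 0, ∀ i, v₀ + ε * w₀ ≤ v i + ε * w i := by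
  obtain ⟨ε, hε, hεle⟩ := exists_pos_forall_le_of_pos fun i => (v i - v₀) / (|w₀ - w i| + 1)
  refine ⟨ε, hε, fun i => ?_⟩
  rcases h i with hlt | ⟨heq, hle⟩
  · have hpos : 0 < |w₀ - w i| + 1 := by positivity
    have hmul := (le_div_iff₀ hpos).1 (hεle i (div_pos (sub_pos.2 hlt) hpos))
    have habs : ε * (w₀ - w i) ≤ ε * (|w₀ - w i| + 1) :=
      mul_le_mul_of_nonneg_left ((le_abs_self _).trans (le_add_of_nonneg_right zero_le_one)) hε.le
    linarith
  · exact add_le_add heq.le (mul_le_mul_of_nonneg_left hle hε.le)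

theorem card_filter_eq_of_forall_exists {ι κ : Type*} [DecidableEq κ] {s : Finset ι} {g : ι → κ}
    (hg : Set.InjOn g s) {F : Finset κ} (h : ∀ f ∈ F, ∃ p ∈ s, g p = f) :
    {p ∈ s | g p ∈ F}.card = F.card := by
  rw [← Finset.card_image_of_injOn (hg.mono (Finset.coe_subset.2 (Finset.filter_subset _ s)))]
  congr 1
  ext f
  simp only [Finset.mem_image, Finset.mem_filter]
  exact ⟨fun ⟨_, ⟨_, hp⟩, hpf⟩ => hpf ▸ hp, fun hf =>
    let ⟨p, hp, hpf⟩ := h f hf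
    ⟨p, ⟨hp, hpf.symm ▸ hf⟩, hpf⟩⟩

theorem IsGeneric.optValue_lt_or_eq_of_isMatching (hA : IsGeneric Z A) (hj : j + 1 ≤ min m n)
    (hZ : NoZeroAssignment Z (j + 1)) {c : ℝ} (hc : optValue A (j + 1) - optValue A j = c)
    (hs : IsMatching s) :
    optValue A j - j * c < cost A s - s.card * c ∨
      optValue A j - j * c = cost A s - s.card * c ∧
        (commonRows A j).card ≤ {p ∈ s | p.1 ∈ commonRows A j}.card := by
  have hassign := hs.isAssignment rfl
  have hcommon : cost A s = optValue A s.card → commonRows A j ⊆ commonRows A s.card →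
      (commonRows A j).card ≤ {p ∈ s | p.1 ∈ commonRows A j}.card := fun hopt hsub =>
    (card_filter_eq_of_forall_exists hs.rows fun f hf => exists_mem_fst_eq_of_mem_commonRows
      (hassign.isOptimal hopt.le) (hsub hf)).ge
  by_cases hline : s.card = j ∨ s.card = j + 1
  · have hvalue : optValue A s.card - s.card * c = optValue A j - j * c := by
      rcases hline with h | h <;> rw [h]
      push_cast
      linarith
    rcases hassign.optValue_le.lt_or_eq (b := cost A s) with hlt | heq
    · exact .inl (by linarith)
    · refine .inr ⟨by linarith, hcommon heq.symm ?_⟩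
      rcases hline with h | h <;> rw [h]
      exact hA.commonRows_subset_succ hj hZ
  · obtain ⟨hne, hne'⟩ := not_or.1 hline
    have hlt := hA.optValue_lt_sub_mul hj hZ hassign.le_min hne hne'
    rw [hc] at hlt
    exact .inl (hlt.trans_le (sub_le_sub_right hassign.optValue_le _))

/-- Egerváry's theorem for the weights `c - A i b`, where `c` is the increment of the optimal value
at `j`. Lowering the weights in the common rows by a small `ε` does not change the extremal
matchings, and gives `y` room to be at least `ε` there. -/
theorem IsGeneric.exists_isPotential (hA : IsGeneric Z A) (hj : j + 1 ≤ min m n)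
    (hZ : NoZeroAssignment Z (j + 1)) : ∃ c y z, IsPotential A j c y z := by
  set c := optValue A (j + 1) - optValue A j with hc
  set F := commonRows A j
  obtain ⟨ε, hε, hεle⟩ := exists_pos_forall_add_mul_le
    (ι := {s : Finset (Fin m × Fin n) // IsMatching s})
    (w := fun s => ({p ∈ s.1 | p.1 ∈ F}.card : ℝ)) (w₀ := F.card)
    fun s => (hA.optValue_lt_or_eq_of_isMatching hj hZ hc.symm s.2).imp_right
      (And.imp_right Nat.cast_le.2)
  obtain ⟨y, z, M, hyz, hM, hsum⟩ := exists_weightCover_eq_matching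
    fun i b => c - A i b - if i ∈ F then ε else 0
  have hbonus : ∀ i, 0 ≤ if i ∈ F then ε else 0 := fun i => by positivity
  have hcover : IsWeightCover (fun i b => c - A i b) (fun i => y i + if i ∈ F then ε else 0) z :=
    ⟨fun i => add_nonneg (hyz.row_nonneg i) (hbonus i), hyz.col_nonneg,
      fun i b => by linarith [hyz.le_add i b]⟩
  have hvalue : j * c - (∑ i, (y i + if i ∈ F then ε else 0) + ∑ b, z b) = optValue A j := by
    refine le_antisymm ?_ ?_
    · obtain ⟨s, hs⟩ := exists_isOptimal A (show j ≤ min m n by omega)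
      have hweak := hcover.sum_le hs.1.isMatching
      rw [hs.1.sum_sub, hs.cost_eq] at hweak
      linarith
    · have hM_le : optValue A j - j * c + ε * F.card ≤ _ := hεle ⟨M, hM⟩
      rw [Finset.sum_sub_distrib, (hM.isAssignment rfl).sum_sub, ← Finset.sum_filter,
        Finset.sum_const, nsmul_eq_mul] at hsum
      rw [Finset.sum_add_distrib, ← Finset.sum_filter, Finset.sum_const, nsmul_eq_mul,
        Finset.filter_mem_eq_inter, Finset.univ_inter]
      linarith
  refine ⟨c, _, z, hcover, sub_pos.2 (hA.optValue_lt_succ hj hZ), hvalue, ?_, fun i hi => ?_⟩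
  · push_cast
    linarith
  · rw [if_pos hi]
    exact add_pos_of_nonneg_of_pos (hyz.row_nonneg i) hε

end Potential

end Optimal

section Structure

variable {m n : ℕ} {A : Fin m → Fin n → ℝ} {Z s t : Finset (Fin m × Fin n)} {j k : ℕ}
  {c : ℝ} {y : Fin m → ℝ} {z : Fin n → ℝ}

open scoped Classical in
/-- The columns with an element of `Z` outside the rows `F`: they extend the rows `F` to a cover
of `Z` in the cheapest way. -/
noncomputable def zeroCols (Z : Finset (Fin m × Fin n)) (F : Finset (Fin m)) : Finset (Fin n) :=
  {b | ∃ i ∉ F, (i, b) ∈ Z}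

theorem mem_zeroCols {F : Finset (Fin m)} {b : Fin n} :
    b ∈ zeroCols Z F ↔ ∃ i ∉ F, (i, b) ∈ Z := by
  simp [zeroCols]

theorem covers_zeroCols (Z : Finset (Fin m × Fin n)) (F : Finset (Fin m)) :
    Covers Z F (zeroCols Z F) := fun p hp =>
  or_iff_not_imp_left.2 fun hpF => mem_zeroCols.2 ⟨p.1, hpF, hp⟩

theorem card_le_of_forall_mem_or (hs : IsMatching s) {R : Finset (Fin m)} {C : Finset (Fin n)}
    (h : ∀ p ∈ s, p.1 ∈ R ∨ p.2 ∈ C) : s.card ≤ R.card + C.card := by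
  rw [← Finset.card_filter_add_card_filter_not (s := s) (fun p => p.1 ∈ R)]
  exact add_le_add
    (Finset.card_le_card_of_injOn Prod.fst (fun p hp => (Finset.mem_filter.1 hp).2)
      (hs.subset (Finset.filter_subset _ _)).rows)
    (Finset.card_le_card_of_injOn Prod.snd (fun p hp =>
      (h p (Finset.mem_filter.1 hp).1).resolve_left (Finset.mem_filter.1 hp).2)
      (hs.subset (Finset.filter_subset _ _)).cols)

theorem card_eq_add_card_filter_of_lines (hs : IsMatching s) {F : Finset (Fin m)}
    {C : Finset (Fin n)} (hF : ∀ f ∈ F, ∃ p ∈ s, p.1 = f) (hC : ∀ b ∈ C, ∃ p ∈ s, p.2 = b)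
    (hFC : ∀ p ∈ s, p.2 ∈ C → p.1 ∉ F) :
    s.card = F.card + C.card + {p ∈ s | p.1 ∉ F ∧ p.2 ∉ C}.card := by
  have hrows := Finset.card_filter_add_card_filter_not (s := s) (fun p => p.1 ∈ F)
  have hcols := Finset.card_filter_add_card_filter_not (s := {p ∈ s | p.1 ∉ F}) (fun p => p.2 ∈ C)
  have hFC' : {p ∈ s | p.1 ∉ F ∧ p.2 ∈ C} = {p ∈ s | p.2 ∈ C} :=
    Finset.filter_congr fun p hp => and_iff_right_of_imp (hFC p hp)
  rw [Finset.filter_filter, Finset.filter_filter, hFC',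
    card_filter_eq_of_forall_exists hs.cols hC] at hcols
  rw [card_filter_eq_of_forall_exists hs.rows hF] at hrows
  omega

namespace IsPotential

theorem slackness (h : IsPotential A j c y z) (hs : IsOptimal A j s) :
    (∀ p ∈ s, c - A p.1 p.2 = y p.1 + z p.2) ∧ (∀ i, 0 < y i → ∃ p ∈ s, p.1 = i) ∧
      ∀ b, 0 < z b → ∃ p ∈ s, p.2 = b :=
  h.complementary_slackness hs.1.isMatching
    (by rw [hs.1.sum_sub, hs.cost_eq, ← h.value, sub_sub_cancel])

theorem slackness_succ (h : IsPotential A j c y z) (hs : IsOptimal A (j + 1) s) :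
    (∀ p ∈ s, c - A p.1 p.2 = y p.1 + z p.2) ∧ (∀ i, 0 < y i → ∃ p ∈ s, p.1 = i) ∧
      ∀ b, 0 < z b → ∃ p ∈ s, p.2 = b :=
  h.complementary_slackness hs.1.isMatching
    (by rw [hs.1.sum_sub, hs.cost_eq, ← h.value_succ, sub_sub_cancel])

theorem row_eq_zero (h : IsPotential A j c y z) {i : Fin m} (hi : i ∉ commonRows A j) :
    y i = 0 := by
  obtain ⟨s, hs, hsi⟩ := exists_isOptimal_forall_fst_ne hi
  refine ((h.row_nonneg i).eq_of_not_lt fun hlt => ?_).symm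
  obtain ⟨p, hp, hpi⟩ := (h.slackness hs).2.1 i hlt
  exact hsi p hp hpi

theorem le_col (h : IsPotential A j c y z) (hA : IsGeneric Z A) {b : Fin n}
    (hb : b ∈ zeroCols Z (commonRows A j)) : c ≤ z b := by
  obtain ⟨i, hi, hib⟩ := mem_zeroCols.1 hb
  have hzero : A i b = 0 := hA.zero _ hib
  have hle := h.le_add i b
  rwa [hzero, sub_zero, h.row_eq_zero hi, zero_add] at hle

theorem notMem_and_mem_of_mem_zeroCols (h : IsPotential A j c y z) (hA : IsGeneric Z A)
    {p : Fin m × Fin n} (hp : c - A p.1 p.2 = y p.1 + z p.2)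
    (hb : p.2 ∈ zeroCols Z (commonRows A j)) : p.1 ∉ commonRows A j ∧ p ∈ Z := by
  have hc := h.le_col hA hb
  refine ⟨fun hF => ?_, by_contra fun hpZ => ?_⟩
  · linarith [h.row_pos _ hF, hA.nonneg p]
  · linarith [h.row_nonneg p.1, hA.pos p hpZ]

end IsPotential

theorem IsGeneric.mem_commonRows_or_mem_zeroCols (hA : IsGeneric Z A) (hs : IsOptimal A j s)
    {p : Fin m × Fin n} (hp : p ∈ s) : p.1 ∈ commonRows A j ∨ p.2 ∈ zeroCols Z (commonRows A j) :=
  or_iff_not_imp_left.2 fun hpF => mem_zeroCols.2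
    ⟨p.1, hpF, by_contra fun hpZ => hpF (hA.mem_commonRows_of_mem hs hp hpZ)⟩

theorem IsGeneric.card_commonRows_add_card_zeroCols (hA : IsGeneric Z A) (hj : j + 1 ≤ min m n)
    (hZ : NoZeroAssignment Z (j + 1)) :
    (commonRows A j).card + (zeroCols Z (commonRows A j)).card = j := by
  obtain ⟨c, y, z, h⟩ := hA.exists_isPotential hj hZ
  obtain ⟨s, hs⟩ := exists_isOptimal A (show j ≤ min m n by omega)
  obtain ⟨htight, -, hcols⟩ := h.slackness hs
  have hcard := card_eq_add_card_filter_of_lines hs.1.isMatching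
    (fun f => exists_mem_fst_eq_of_mem_commonRows hs)
    (fun b hb => hcols b (h.pos.trans_le (h.le_col hA hb)))
    (fun p hp hb => (h.notMem_and_mem_of_mem_zeroCols hA (htight p hp) hb).1)
  rw [hs.1.card_eq, Finset.filter_false_of_mem fun p hp => not_and_or.2 <|
    (hA.mem_commonRows_or_mem_zeroCols hs hp).imp not_not.2 not_not.2] at hcard
  exact hcard.symm

theorem IsGeneric.lt_card_cover (hA : IsGeneric Z A) {a : Fin m} (ha : a ∉ commonRows A j)
    {R : Finset (Fin m)} {C : Finset (Fin n)} (hR : commonRows A j ⊆ R) (haR : a ∈ R)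
    (hc : Covers Z R C) : j < R.card + C.card := by
  obtain ⟨s, hs, hsa⟩ := exists_isOptimal_forall_fst_ne ha
  have hle : s.card ≤ (R.erase a).card + C.card :=
    card_le_of_forall_mem_or hs.1.isMatching fun p hp => by
      by_cases hpZ : p ∈ Z
      · exact (hc p hpZ).imp_left fun h => Finset.mem_erase.2 ⟨hsa p hp, h⟩
      · exact .inl (Finset.mem_erase.2 ⟨hsa p hp, hR (hA.mem_commonRows_of_mem hs hp hpZ)⟩)
  rw [hs.1.card_eq] at hle
  have hlt := Finset.card_erase_lt_of_mem haR
  omega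

/-- Some optimal `k`-assignment has a position outside `Z` in the row `a`. For `k = j + 1` and `a`
outside `commonRows A j`, this singles out the row that is new in the common rows. -/
def HasNonzeroInRow (A : Fin m → Fin n → ℝ) (Z : Finset (Fin m × Fin n)) (k : ℕ) (a : Fin m) :
    Prop :=
  ∃ s, IsOptimal A k s ∧ ∃ b, (a, b) ∈ s ∧ (a, b) ∉ Z

theorem IsGeneric.mem_commonRows_of_hasNonzeroInRow (hA : IsGeneric Z A) {a : Fin m}
    (h : HasNonzeroInRow A Z k a) : a ∈ commonRows A k := by
  obtain ⟨s, hs, b, hb, hbZ⟩ := h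
  exact hA.mem_commonRows_of_mem hs hb hbZ

theorem hasNonzeroInRow_of_mem_commonRows (hk : k ≤ min m n) {r : Fin m}
    (hr : ∀ b, (r, b) ∉ Z) (h : r ∈ commonRows A k) : HasNonzeroInRow A Z k r := by
  obtain ⟨s, hs⟩ := exists_isOptimal A hk
  obtain ⟨b, hb⟩ := mem_commonRows.1 h s hs
  exact ⟨s, hs, b, hb, hr b⟩

theorem IsGeneric.notMem_and_mem_of_isOptimal_succ (hA : IsGeneric Z A) (hj : j + 1 ≤ min m n)
    (hZ : NoZeroAssignment Z (j + 1)) (hs : IsOptimal A (j + 1) s) {p : Fin m × Fin n}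
    (hp : p ∈ s) (hb : p.2 ∈ zeroCols Z (commonRows A j)) : p.1 ∉ commonRows A j ∧ p ∈ Z := by
  obtain ⟨c, y, z, h⟩ := hA.exists_isPotential hj hZ
  exact h.notMem_and_mem_of_mem_zeroCols hA ((h.slackness_succ hs).1 p hp) hb

theorem IsGeneric.existsUnique_new_position (hA : IsGeneric Z A) (hj : j + 1 ≤ min m n)
    (hZ : NoZeroAssignment Z (j + 1)) (hs : IsOptimal A (j + 1) s) :
    ∃! q, q ∈ s ∧ q.1 ∉ commonRows A j ∧ q.2 ∉ zeroCols Z (commonRows A j) := by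
  obtain ⟨c, y, z, h⟩ := hA.exists_isPotential hj hZ
  obtain ⟨-, hrows, hcols⟩ := h.slackness_succ hs
  have hcard := card_eq_add_card_filter_of_lines hs.1.isMatching
    (fun f hf => hrows f (h.row_pos f hf))
    (fun b hb => hcols b (h.pos.trans_le (h.le_col hA hb)))
    fun p hp hb => (hA.notMem_and_mem_of_isOptimal_succ hj hZ hs hp hb).1
  rw [hs.1.card_eq, hA.card_commonRows_add_card_zeroCols hj hZ, add_right_inj] at hcard
  obtain ⟨q, hq⟩ := Finset.card_eq_one.1 hcard.symm
  refine ⟨q, Finset.mem_filter.1 (hq ▸ Finset.mem_singleton_self q), fun p hp => ?_⟩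
  rw [← Finset.mem_singleton, ← hq, Finset.mem_filter]
  exact hp

theorem IsGeneric.existsUnique_newRow (hA : IsGeneric Z A) (hj : j + 1 ≤ min m n)
    (hZ : NoZeroAssignment Z (j + 1)) :
    ∃! a, a ∉ commonRows A j ∧ HasNonzeroInRow A Z (j + 1) a := by
  obtain ⟨s, hs⟩ := exists_isOptimal A hj
  obtain ⟨q, ⟨hq, hqF, hqC⟩, huniq⟩ := hA.existsUnique_new_position hj hZ hs
  refine ⟨q.1, ⟨hqF, s, hs, q.2, hq, fun hqZ => hqC (mem_zeroCols.2 ⟨q.1, hqF, hqZ⟩)⟩, ?_⟩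
  rintro a ⟨haF, t, ht, b, hb, hbZ⟩
  have hbs : (a, b) ∈ s := hA.mem_of_isOptimal ht hs hb hbZ
  rw [← huniq (a, b) ⟨hbs, haF, fun hbC =>
    hbZ (hA.notMem_and_mem_of_isOptimal_succ hj hZ hs hbs hbC).2⟩]

end Structure

section SwapRows

variable {m n : ℕ} {A : Fin m → Fin n → ℝ} {Z s t : Finset (Fin m × Fin n)} {j : ℕ}
  {c : ℝ} {y : Fin m → ℝ} {z : Fin n → ℝ} {C : Finset (Fin n)} {a a' : Fin m} {b : Fin n}

/-- Exchange the rows `a` and `a'` in all columns outside `C`. -/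
def swapRows (C : Finset (Fin n)) (a a' : Fin m) (A : Fin m → Fin n → ℝ) : Fin m → Fin n → ℝ :=
  fun i b => if b ∈ C then A i b else A (Equiv.swap a a' i) b

theorem swapRows_apply_of_mem (hb : b ∈ C) (i : Fin m) : swapRows C a a' A i b = A i b :=
  if_pos hb

theorem swapRows_apply_of_notMem (hb : b ∉ C) (i : Fin m) :
    swapRows C a a' A i b = A (Equiv.swap a a' i) b :=
  if_neg hb

theorem swapRows_apply_eq_self {F : Finset (Fin m)} (ha : a ∉ F) (ha' : a' ∉ F)
    {p : Fin m × Fin n} (hp : p.1 ∈ F ∨ p.2 ∈ C) : swapRows C a a' A p.1 p.2 = A p.1 p.2 := by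
  by_cases hb : p.2 ∈ C
  · exact swapRows_apply_of_mem hb p.1
  · have hpF := hp.resolve_right hb
    rw [swapRows_apply_of_notMem hb, Equiv.swap_apply_of_ne_of_ne (ne_of_mem_of_not_mem hpF ha)
      (ne_of_mem_of_not_mem hpF ha')]

theorem IsPotential.isWeightCover_swapRows (h : IsPotential A j c y z) (C : Finset (Fin n))
    (ha : a ∉ commonRows A j) (ha' : a' ∉ commonRows A j) :
    IsWeightCover (fun i b => c - swapRows C a a' A i b) y z := by
  refine ⟨h.row_nonneg, h.col_nonneg, fun i b => ?_⟩
  by_cases hb : b ∈ C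
  · rw [swapRows_apply_of_mem hb]
    exact h.le_add i b
  · have hy : y (Equiv.swap a a' i) = y i :=
      Equiv.apply_swap_eq_self ((h.row_eq_zero ha).trans (h.row_eq_zero ha').symm) i
    rw [swapRows_apply_of_notMem hb, ← hy]
    exact h.le_add _ b

theorem IsGeneric.cost_swapRows (hA : IsGeneric Z A) (hs : IsOptimal A j s)
    (ha : a ∉ commonRows A j) (ha' : a' ∉ commonRows A j) :
    cost (swapRows (zeroCols Z (commonRows A j)) a a' A) s = cost A s :=
  Finset.sum_congr rfl fun _ hp =>
    swapRows_apply_eq_self ha ha' (hA.mem_commonRows_or_mem_zeroCols hs hp)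

theorem IsPotential.optValue_le_optValue_swapRows (h : IsPotential A j c y z)
    (C : Finset (Fin n)) (ha : a ∉ commonRows A j) (ha' : a' ∉ commonRows A j) :
    (∀ t, IsAssignment j t → optValue A j ≤ cost (swapRows C a a' A) t) ∧
      ∀ t, IsAssignment (j + 1) t → optValue A (j + 1) ≤ cost (swapRows C a a' A) t := by
  refine ⟨fun t ht => ?_, fun t ht => ?_⟩ <;>
    have hle := (h.isWeightCover_swapRows C ha ha').sum_le ht.isMatching <;>
    rw [ht.sum_sub] at hle
  · linarith [h.value]
  · linarith [h.value_succ]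

theorem IsGeneric.isOptimal_swapRows (hA : IsGeneric Z A) (hj : j + 1 ≤ min m n)
    (hZ : NoZeroAssignment Z (j + 1)) (ha : a ∉ commonRows A j) (ha' : a' ∉ commonRows A j)
    (hs : IsOptimal A j s) :
    IsOptimal (swapRows (zeroCols Z (commonRows A j)) a a' A) j s := by
  obtain ⟨c, y, z, h⟩ := hA.exists_isPotential hj hZ
  refine ⟨hs.1, fun t ht => ?_⟩
  rw [hA.cost_swapRows hs ha ha', hs.cost_eq]
  exact (h.optValue_le_optValue_swapRows _ ha ha').1 t ht

theorem IsGeneric.commonRows_swapRows (hA : IsGeneric Z A) (hj : j + 1 ≤ min m n)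
    (hZ : NoZeroAssignment Z (j + 1)) (ha : a ∉ commonRows A j) (ha' : a' ∉ commonRows A j)
    (hA' : IsGeneric Z (swapRows (zeroCols Z (commonRows A j)) a a' A)) :
    commonRows (swapRows (zeroCols Z (commonRows A j)) a a' A) j = commonRows A j := by
  have hsub : commonRows (swapRows (zeroCols Z (commonRows A j)) a a' A) j ⊆ commonRows A j :=
    fun i hi => mem_commonRows.2 fun t ht =>
      mem_commonRows.1 hi t (hA.isOptimal_swapRows hj hZ ha ha' ht)
  refine hsub.antisymm fun f hf => by_contra fun hf' => ?_
  have hlt := hA'.lt_card_cover hf' hsub hf (covers_zeroCols Z _)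
  exact hlt.ne' (hA.card_commonRows_add_card_zeroCols hj hZ)

theorem IsMatching.insert (hs : IsMatching s) {q : Fin m × Fin n}
    (hq : ∀ p ∈ s, p.1 ≠ q.1 ∧ p.2 ≠ q.2) : IsMatching (insert q s) := by
  have hqs : q ∉ (s : Set (Fin m × Fin n)) := fun h => (hq q h).1 rfl
  constructor <;> rw [Finset.coe_insert, Set.injOn_insert hqs]
  · exact ⟨hs.rows, fun ⟨p, hp, hpq⟩ => (hq p hp).1 hpq⟩
  · exact ⟨hs.cols, fun ⟨p, hp, hpq⟩ => (hq p hp).2 hpq⟩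

/-- Keep the part of an optimal `(j + 1)`-assignment `s` in the common rows, take the rest of an
optimal `j`-assignment `t` that avoids `a'`, and move the new position of `s` to the row `a'`. -/
theorem IsGeneric.isAssignment_insert_replaceOn (hA : IsGeneric Z A) (hj : j + 1 ≤ min m n)
    (hZ : NoZeroAssignment Z (j + 1)) (ha : a ∉ commonRows A j) (ha' : a' ∉ commonRows A j)
    (hs : IsOptimal A (j + 1) s) (hb : (a, b) ∈ s) (hbZ : (a, b) ∉ Z) (ht : IsOptimal A j t)
    (hta : ∀ p ∈ t, p.1 ≠ a') :
    IsAssignment (j + 1) (insert (a', b) (replaceOn t s (commonRows A j))) := by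
  set F := commonRows A j
  have hbC : b ∉ zeroCols Z F := fun hbC =>
    hbZ (hA.notMem_and_mem_of_isOptimal_succ hj hZ hs hb hbC).2
  have htC : ∀ p ∈ t, p.1 ∉ F → p.2 ∈ zeroCols Z F := fun p hp =>
    (hA.mem_commonRows_or_mem_zeroCols ht hp).resolve_left
  have hmatching : IsMatching (replaceOn t s F) :=
    ht.1.isMatching.replaceOn hs.1.isMatching (C := (zeroCols Z F)ᶜ)
      (fun p hp hpF => Finset.notMem_compl.2 (htC p hp hpF))
      fun p hp hpF => Finset.mem_compl.2 fun hpC =>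
        (hA.notMem_and_mem_of_isOptimal_succ hj hZ hs hp hpC).1 hpF
  have hnew : ∀ p ∈ replaceOn t s F, p.1 ≠ a' ∧ p.2 ≠ b := by
    intro p hp
    rcases mem_replaceOn.1 hp with ⟨hp, hpF⟩ | ⟨hp, hpF⟩
    · exact ⟨hta p hp, ne_of_mem_of_not_mem (htC p hp hpF) hbC⟩
    · refine ⟨ne_of_mem_of_not_mem hpF ha', fun hpb => ha ?_⟩
      rwa [hs.1.isMatching.eq_of_snd hp hb hpb] at hpF
  refine (hmatching.insert hnew).isAssignment ?_
  have hcard := Finset.card_filter_add_card_filter_not (s := t) (fun p => p.1 ∈ F)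
  rw [Finset.card_insert_of_notMem fun h => (hnew _ h).1 rfl, card_replaceOn,
    card_filter_eq_of_forall_exists hs.1.isMatching.rows fun f hf =>
      exists_mem_fst_eq_of_mem_commonRows hs (hA.commonRows_subset_succ hj hZ hf)]
  rw [ht.1.card_eq, card_filter_eq_of_forall_exists ht.1.isMatching.rows fun f =>
    exists_mem_fst_eq_of_mem_commonRows ht] at hcard
  omega

theorem IsGeneric.cost_swapRows_insert_replaceOn_le (hA : IsGeneric Z A)
    (ha : a ∉ commonRows A j) (ha' : a' ∉ commonRows A j) (hb : (a, b) ∈ s)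
    (hbC : b ∉ zeroCols Z (commonRows A j)) (ht : IsOptimal A j t) (hta : ∀ p ∈ t, p.1 ≠ a') :
    cost (swapRows (zeroCols Z (commonRows A j)) a a' A)
      (insert (a', b) (replaceOn t s (commonRows A j))) ≤ cost A s := by
  set F := commonRows A j
  set A' := swapRows (zeroCols Z F) a a' A with hA'
  have hnot : (a', b) ∉ replaceOn t s F := fun h =>
    (mem_replaceOn.1 h).elim (fun h => hta _ h.1 rfl) fun h => ha' h.2
  have hnot' : (a, b) ∉ ({p ∈ s | p.1 ∈ F} : Finset _) := fun h => ha (Finset.mem_filter.1 h).2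
  have hnew : A' a' b = A a b := by
    rw [hA', swapRows_apply_of_notMem hbC, Equiv.swap_apply_right]
  have hkept : ∑ p ∈ s with p.1 ∈ F, A' p.1 p.2 = ∑ p ∈ s with p.1 ∈ F, A p.1 p.2 :=
    Finset.sum_congr rfl fun p hp =>
      swapRows_apply_eq_self ha ha' (.inl (Finset.mem_filter.1 hp).2)
  have hzero : ∑ p ∈ t with p.1 ∉ F, A' p.1 p.2 = 0 := Finset.sum_eq_zero fun p hp => by
    obtain ⟨hp, hpF⟩ := Finset.mem_filter.1 hp
    rw [hA', swapRows_apply_eq_self ha ha' (hA.mem_commonRows_or_mem_zeroCols ht hp)]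
    exact hA.zero p (by_contra fun hpZ => hpF (hA.mem_commonRows_of_mem ht hp hpZ))
  calc cost A' (insert (a', b) (replaceOn t s F))
      = A a b + ∑ p ∈ s with p.1 ∈ F, A p.1 p.2 := by
        rw [cost, Finset.sum_insert hnot, sum_replaceOn, hzero, hkept, hnew, zero_add]
    _ = cost A (insert (a, b) {p ∈ s | p.1 ∈ F}) := by rw [cost, Finset.sum_insert hnot']
    _ ≤ cost A s := hA.cost_mono (Finset.insert_subset hb (Finset.filter_subset _ s))

theorem IsGeneric.hasNonzeroInRow_swapRows (hA : IsGeneric Z A) (hj : j + 1 ≤ min m n)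
    (hZ : NoZeroAssignment Z (j + 1)) (ha : a ∉ commonRows A j) (ha' : a' ∉ commonRows A j)
    (h : HasNonzeroInRow A Z (j + 1) a) :
    HasNonzeroInRow (swapRows (zeroCols Z (commonRows A j)) a a' A) Z (j + 1) a' := by
  obtain ⟨s, hs, b, hb, hbZ⟩ := h
  obtain ⟨t, ht, hta⟩ := exists_isOptimal_forall_fst_ne ha'
  obtain ⟨c, y, z, hpot⟩ := hA.exists_isPotential hj hZ
  have hbC : b ∉ zeroCols Z (commonRows A j) := fun hbC =>
    hbZ (hA.notMem_and_mem_of_isOptimal_succ hj hZ hs hb hbC).2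
  refine ⟨_, ⟨hA.isAssignment_insert_replaceOn hj hZ ha ha' hs hb hbZ ht hta, fun u hu => ?_⟩, b,
    Finset.mem_insert_self _ _, fun hbZ' => hbC (mem_zeroCols.2 ⟨a', ha', hbZ'⟩)⟩
  calc _ ≤ cost A s := hA.cost_swapRows_insert_replaceOn_le ha ha' hb hbC ht hta
    _ = optValue A (j + 1) := hs.cost_eq
    _ ≤ _ := (hpot.optValue_le_optValue_swapRows _ ha ha').2 u hu

end SwapRows

section RandomOrder

/-- The probability that, in a uniformly random order of `M + 1` objects, the objects before a given
one form a given set of `i` others. -/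
noncomputable def orderWeight (M i : ℕ) : ℝ := 1 / ((M + 1) * M.choose i)

theorem orderWeight_zero (M : ℕ) : orderWeight M 0 = 1 / (M + 1) := by
  simp [orderWeight]

theorem orderWeight_succ {M i : ℕ} (hi : i ≤ M) :
    (M + 2) * orderWeight (M + 1) (i + 1) = (i + 1) * orderWeight M i := by
  have hchoose : ((M : ℝ) + 1) * M.choose i = (M + 1).choose (i + 1) * (i + 1) := by
    exact_mod_cast Nat.add_one_mul_choose_eq M i
  have hpos : (0 : ℝ) < (M + 1).choose (i + 1) := by
    exact_mod_cast Nat.choose_pos (Nat.succ_le_succ hi)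
  rw [orderWeight, orderWeight, hchoose]
  push_cast
  field_simp
  ring

theorem orderWeight_succ_left {M i : ℕ} (hi : i ≤ M) :
    (M + 2) * orderWeight (M + 1) i = (M + 1 - i) * orderWeight M i := by
  have hchoose : (M.choose i : ℝ) * (M + 1) = (M + 1).choose i * (M + 1 - i) := by
    rw [← Nat.cast_add_one, ← Nat.cast_sub (by omega)]
    exact_mod_cast Nat.choose_mul_succ_eq M i
  have hpos : (0 : ℝ) < (M + 1).choose i := by
    exact_mod_cast Nat.choose_pos (hi.trans M.le_succ)
  have hsub : (0 : ℝ) < M + 1 - i := by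
    have hle : (i : ℝ) ≤ M := by exact_mod_cast hi
    linarith
  rw [orderWeight, orderWeight, mul_comm ((M : ℝ) + 1) (M.choose i), hchoose]
  push_cast
  field_simp
  ring

theorem orderWeight_add {M i : ℕ} (hi : i ≤ M) :
    orderWeight (M + 1) i + orderWeight (M + 1) (i + 1) = orderWeight M i := by
  refine mul_left_cancel₀ (show (M : ℝ) + 2 ≠ 0 by positivity) ?_
  rw [mul_add, orderWeight_succ hi, orderWeight_succ_left hi]
  ring

variable {α : Type*} [DecidableEq α]

theorem sum_sum_powerset_erase {M : Type*} [AddCommMonoid M] (U : Finset α)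
    (g : α → Finset α → M) :
    ∑ a ∈ U, ∑ S ∈ (U.erase a).powerset, g a (insert a S) = ∑ T ∈ U.powerset, ∑ a ∈ T, g a T := by
  rw [Finset.sum_sigma', Finset.sum_sigma']
  refine Finset.sum_bij' (fun x _ => ⟨insert x.1 x.2, x.1⟩) (fun x _ => ⟨x.2, x.1.erase x.2⟩)
    ?_ ?_ ?_ ?_ fun _ _ => rfl
  all_goals
    rintro ⟨x, y⟩ h
    simp only [Finset.mem_sigma, Finset.mem_powerset, Finset.subset_erase] at h
  · exact Finset.mem_sigma.2
      ⟨Finset.mem_powerset.2 (Finset.insert_subset h.1 h.2.1), Finset.mem_insert_self x y⟩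
  · exact Finset.mem_sigma.2
      ⟨h.1 h.2, Finset.mem_powerset.2 (Finset.erase_subset_erase y h.1)⟩
  · simp only [Finset.erase_insert h.2.2]
  · simp only [Finset.insert_erase h.2]

/-- The mean of `f` at the set of the objects of `U` that precede an additional object, when these
`U.card + 1` objects are in uniformly random order. -/
noncomputable def meanPredecessors (U : Finset α) (f : Finset α → ℝ) : ℝ :=
  ∑ T ∈ U.powerset, orderWeight U.card T.card * f T

/-- Condition on the first object of the order. -/
theorem meanPredecessors_eq_first (U : Finset α) (f : Finset α → ℝ) :
    (U.card + 1) * meanPredecessors U f =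
      f ∅ + ∑ a ∈ U, meanPredecessors (U.erase a) fun S => f (insert a S) := by
  have hfirst : ∑ a ∈ U, meanPredecessors (U.erase a) (fun S => f (insert a S)) =
      ∑ T ∈ U.powerset.erase ∅, ∑ _a ∈ T, orderWeight (U.card - 1) (T.card - 1) * f T := by
    refine Eq.trans ?_ (Finset.sum_erase _ (by rw [Finset.sum_empty])).symm
    rw [← sum_sum_powerset_erase U fun _ T => orderWeight (U.card - 1) (T.card - 1) * f T]
    refine Finset.sum_congr rfl fun a ha => Finset.sum_congr rfl fun S hS => ?_
    have haS : a ∉ S := (Finset.subset_erase.1 (Finset.mem_powerset.1 hS)).2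
    rw [Finset.card_erase_of_mem ha, Finset.card_insert_of_notMem haS, Nat.add_sub_cancel]
  have hempty : ((U.card : ℝ) + 1) * (orderWeight U.card 0 * f ∅) = f ∅ := by
    rw [orderWeight_zero, ← mul_assoc, mul_one_div_cancel (by positivity), one_mul]
  rw [hfirst, meanPredecessors, Finset.mul_sum,
    ← Finset.add_sum_erase _ _ (Finset.empty_mem_powerset U), Finset.card_empty, hempty]
  congr 1
  refine Finset.sum_congr rfl fun T hT => ?_
  obtain ⟨hT, hTU⟩ := Finset.mem_erase.1 hT
  have hle := Finset.card_le_card (Finset.mem_powerset.1 hTU)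
  obtain ⟨i, hi⟩ : ∃ i, T.card = i + 1 :=
    Nat.exists_eq_add_one.2 (Finset.card_pos.2 (Finset.nonempty_iff_ne_empty.2 hT))
  obtain ⟨M, hM⟩ : ∃ M, U.card = M + 1 := Nat.exists_eq_add_one.2 (by omega)
  have hweight := orderWeight_succ (show i ≤ M by omega)
  rw [Finset.sum_const, hi, hM, nsmul_eq_mul, Nat.add_sub_cancel, Nat.add_sub_cancel]
  push_cast
  linear_combination f T * hweight

theorem meanPredecessors_erase (U : Finset α) (f : Finset α → ℝ) {e : α} (he : e ∈ U)
    (hf : ∀ S ⊆ U.erase e, f (insert e S) = f S) :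
    meanPredecessors (U.erase e) f = meanPredecessors U f := by
  obtain ⟨M, hM⟩ : ∃ M, U.card = M + 1 := Nat.exists_eq_add_one.2 (Finset.card_pos.2 ⟨e, he⟩)
  have hcard : (U.erase e).card = M := by rw [Finset.card_erase_of_mem he, hM, Nat.add_sub_cancel]
  have hsplit := Finset.sum_powerset_insert (Finset.notMem_erase e U)
    fun T => orderWeight (M + 1) T.card * f T
  rw [Finset.insert_erase he] at hsplit
  rw [meanPredecessors, meanPredecessors, hM, hsplit, hcard, ← Finset.sum_add_distrib]
  refine Finset.sum_congr rfl fun S hS => ?_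
  rw [Finset.mem_powerset] at hS
  rw [hf S hS, Finset.card_insert_of_notMem (Finset.subset_erase.1 hS).2, ← add_mul,
    orderWeight_add (hcard ▸ Finset.card_le_card hS)]

end RandomOrder

section Covers

variable {m n : ℕ} {Z : Finset (Fin m × Fin n)} {k : ℕ} {r : Fin m} {B F S : Finset (Fin m)}

theorem Covers.inter_union {R R' : Finset (Fin m)} {C C' : Finset (Fin n)} (h : Covers Z R C)
    (h' : Covers Z R' C') : Covers Z (R ∩ R') (C ∪ C') := fun p hp => by
  rcases h p hp with hR | hC
  · exact (h' p hp).imp (fun hR' => Finset.mem_inter.2 ⟨hR, hR'⟩) (Finset.mem_union_right C ·)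
  · exact .inr (Finset.mem_union_left C' hC)

theorem Covers.union_inter {R R' : Finset (Fin m)} {C C' : Finset (Fin n)} (h : Covers Z R C)
    (h' : Covers Z R' C') : Covers Z (R ∪ R') (C ∩ C') := fun p hp => by
  rcases h p hp with hR | hC
  · exact .inl (Finset.mem_union_left R' hR)
  · exact (h' p hp).imp (Finset.mem_union_right R ·) fun hC' => Finset.mem_inter.2 ⟨hC, hC'⟩

/-- The rows `B` can be completed to a cover of `Z` with fewer than `k` lines. -/
def HasSmallCover (Z : Finset (Fin m × Fin n)) (k : ℕ) (B : Finset (Fin m)) : Prop :=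
  ∃ (R : Finset (Fin m)) (C : Finset (Fin n)), B ⊆ R ∧ Covers Z R C ∧ R.card + C.card < k

theorem HasSmallCover.mono (h : HasSmallCover Z k F) (hB : B ⊆ F) : HasSmallCover Z k B := by
  obtain ⟨R, C, hR, hRC⟩ := h
  exact ⟨R, C, hB.trans hR, hRC⟩

theorem HasSmallCover.card_lt (h : HasSmallCover Z k B) : B.card < k := by
  obtain ⟨R, C, hR, -, hcard⟩ := h
  have := Finset.card_le_card hR
  omega

theorem isPartialCover_iff (hk : k ≤ m) : IsPartialCover Z k B ∅ ↔ HasSmallCover Z k B := by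
  constructor
  · rintro ⟨R, C, hR, -, hRC, hcard⟩
    exact ⟨R, C, hR, hRC, by omega⟩
  · rintro ⟨R, C, hR, hRC, hlt⟩
    obtain ⟨R', hRR', hcard⟩ := Finset.exists_superset_card_eq (s := R) (n := k - 1 - C.card)
      (by omega) (by rw [Fintype.card_fin]; omega)
    exact ⟨R', C, hR.trans hRR', Finset.empty_subset C,
      fun p hp => (hRC p hp).imp_left (@hRR' p.1), by omega⟩

/-- Uncrossing: a cover `(R, C')` can be exchanged for `(R ∪ F, C' ∩ C)`, since `(R ∩ F, C' ∪ C)`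
covers `Z` as well. -/
theorem HasSmallCover.union_of_minimal {C : Finset (Fin n)} (hBF : B ⊆ F) (hF : Covers Z F C)
    (hmin : ∀ R C', B ⊆ R → Covers Z R C' → F.card + C.card ≤ R.card + C'.card)
    (h : HasSmallCover Z k (B ∪ S)) : HasSmallCover Z k (F ∪ S) := by
  obtain ⟨R, C', hR, hRC, hlt⟩ := h
  obtain ⟨hBR, hSR⟩ := Finset.union_subset_iff.1 hR
  refine ⟨R ∪ F, C' ∩ C, ?_, hRC.union_inter hF, ?_⟩
  · exact Finset.union_subset Finset.subset_union_right (hSR.trans Finset.subset_union_left)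
  · have hle := hmin (R ∩ F) (C' ∪ C) (Finset.subset_inter hBR hBF) (hRC.inter_union hF)
    have hrows := Finset.card_union_add_card_inter R F
    have hcols := Finset.card_union_add_card_inter C' C
    omega

end Covers

section OrderProb

variable {m n : ℕ} {Z : Finset (Fin m × Fin n)} {k : ℕ} {r : Fin m} {B : Finset (Fin m)}

open scoped Classical in
/-- The probability that, if the rows outside `B` are put in uniformly random order, the rows before
`r` together with `B` have a small cover. It is set to `1` if `r ∈ B`. -/
noncomputable def orderProb (Z : Finset (Fin m × Fin n)) (k : ℕ) (r : Fin m)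
    (B : Finset (Fin m)) : ℝ :=
  if r ∈ B then 1
  else meanPredecessors (Bᶜ.erase r) fun S => if HasSmallCover Z k (B ∪ S) then 1 else 0

theorem orderProb_of_mem (h : r ∈ B) : orderProb Z k r B = 1 := if_pos h

theorem orderProb_of_not_hasSmallCover (hr : r ∉ B) (h : ¬ HasSmallCover Z k B) :
    orderProb Z k r B = 0 := by
  rw [orderProb, if_neg hr]
  refine Finset.sum_eq_zero fun S _ => ?_
  exact mul_eq_zero_of_right _ (if_neg fun hS => h (hS.mono Finset.subset_union_left))

theorem compl_insert_erase (B : Finset (Fin m)) (a r : Fin m) :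
    (insert a B)ᶜ.erase r = (Bᶜ.erase r).erase a := by
  rw [Finset.compl_insert, Finset.erase_right_comm]

theorem sum_orderProb_insert (r : Fin m) (h : HasSmallCover Z k B) :
    ∑ a ∈ Bᶜ, orderProb Z k r (insert a B) = Bᶜ.card * orderProb Z k r B := by
  classical
  by_cases hr : r ∈ B
  · rw [orderProb_of_mem hr, mul_one, Finset.sum_congr rfl fun a _ =>
      orderProb_of_mem (Finset.mem_insert_of_mem hr), Finset.sum_const, nsmul_one]
  · have hcard := Finset.card_erase_add_one (Finset.mem_compl.2 hr)
    rw [← Finset.add_sum_erase _ _ (Finset.mem_compl.2 hr),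
      orderProb_of_mem (Finset.mem_insert_self r B), orderProb, if_neg hr, ← hcard,
      Nat.cast_add_one, meanPredecessors_eq_first, Finset.union_empty, if_pos h]
    congr 1
    refine Finset.sum_congr rfl fun a ha => ?_
    have hra : r ∉ insert a B := fun hra =>
      (Finset.mem_insert.1 hra).elim (Finset.mem_erase.1 ha).1.symm hr
    rw [orderProb, if_neg hra, compl_insert_erase]
    simp only [Finset.union_insert, Finset.insert_union]

theorem orderProb_insert_eq {e : Fin m} (hr : r ∉ insert e B)
    (h : ∀ S, HasSmallCover Z k (B ∪ S) → HasSmallCover Z k (insert e B ∪ S)) :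
    orderProb Z k r (insert e B) = orderProb Z k r B := by
  classical
  by_cases he : e ∈ B
  · rw [Finset.insert_eq_of_mem he]
  obtain ⟨hre, hrB⟩ := not_or.1 (Finset.mem_insert.not.1 hr)
  have hiff : ∀ S, HasSmallCover Z k (insert e B ∪ S) ↔ HasSmallCover Z k (B ∪ S) := fun S =>
    ⟨fun hS => hS.mono (Finset.union_subset_union_left (Finset.subset_insert e B)), h S⟩
  have heU : e ∈ Bᶜ.erase r := Finset.mem_erase.2 ⟨Ne.symm hre, Finset.mem_compl.2 he⟩
  rw [orderProb, orderProb, if_neg hr, if_neg hrB, compl_insert_erase]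
  simp only [hiff]
  refine meanPredecessors_erase _ _ heU fun S _ => ?_
  rw [Finset.union_insert, ← Finset.insert_union]
  simp only [hiff]

theorem orderProb_union_eq {D : Finset (Fin m)} (hr : r ∉ B ∪ D)
    (h : ∀ S, HasSmallCover Z k (B ∪ S) → HasSmallCover Z k (B ∪ D ∪ S)) :
    orderProb Z k r (B ∪ D) = orderProb Z k r B := by
  induction D using Finset.induction_on with
  | empty => rw [Finset.union_empty]
  | insert e D _ ih =>
    rw [Finset.union_insert] at hr h ⊢
    have hsub : B ∪ D ⊆ insert e (B ∪ D) := Finset.subset_insert e _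
    rw [orderProb_insert_eq hr fun S hS => h S (hS.mono
      (Finset.union_subset_union_left Finset.subset_union_left))]
    exact ih (fun hrD => hr (hsub hrD)) fun S hS =>
      (h S hS).mono (Finset.union_subset_union_left hsub)

open scoped Classical in
theorem coverCoeffAvoiding_eq_card (hk : k ≤ m) (i : ℕ) :
    coverCoeffAvoiding Z k r i 0 =
      {S ∈ ((Finset.univ : Finset (Fin m)).erase r).powersetCard i | HasSmallCover Z k S}.card := by
  rw [coverCoeffAvoiding, ← Set.ncard_coe_finset, ← Set.ncard_image_of_injective _
    (Prod.mk_left_injective (α := Finset (Fin m)) (∅ : Finset (Fin n)))]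
  congr 1
  ext ⟨R, C⟩
  simp only [Set.mem_ofPred_eq, Finset.card_eq_zero, Finset.coe_filter, Finset.mem_powersetCard,
    Set.mem_image, Prod.mk.injEq, Finset.subset_erase, Finset.subset_univ, true_and]
  constructor
  · rintro ⟨hR, hcard, rfl, hr⟩
    exact ⟨R, ⟨⟨hr, hcard⟩, (isPartialCover_iff hk).1 hR⟩, rfl, rfl⟩
  · rintro ⟨S, ⟨⟨hr, hcard⟩, hS⟩, rfl, rfl⟩
    exact ⟨(isPartialCover_iff hk).2 hS, hcard, rfl, hr⟩

theorem coverCoeffAvoiding_eq_zero (hk : k ≤ m) {i : ℕ} (hi : k ≤ i) :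
    coverCoeffAvoiding Z k r i 0 = 0 := by
  classical
  rw [coverCoeffAvoiding_eq_card hk, Finset.card_eq_zero]
  refine Finset.filter_false_of_mem fun S hS hsmall => ?_
  exact hsmall.card_lt.not_ge ((Finset.mem_powersetCard.1 hS).2.symm ▸ hi)

theorem orderProb_empty (hk : k ≤ m) (r : Fin m) :
    orderProb Z k r ∅ = 1 / (m : ℝ) * ∑ i ∈ Finset.range k,
      (coverCoeffAvoiding Z k r i 0 : ℝ) / ((m - 1).choose i : ℝ) := by
  classical
  set U := (Finset.univ : Finset (Fin m)).erase r with hUdef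
  have hU : U.card + 1 = m := by
    rw [Finset.card_erase_add_one (Finset.mem_univ r), Finset.card_univ, Fintype.card_fin]
  have hterm : ∀ i, ∑ S ∈ U.powersetCard i,
      (orderWeight U.card S.card * if HasSmallCover Z k S then 1 else 0) =
      1 / (m : ℝ) * ((coverCoeffAvoiding Z k r i 0 : ℝ) / ((m - 1).choose i : ℝ)) := by
    intro i
    rw [coverCoeffAvoiding_eq_card hk, Finset.sum_congr rfl fun S hS => by
      rw [(Finset.mem_powersetCard.1 hS).2], ← Finset.mul_sum, Finset.sum_boole, orderWeight,
      ← Nat.cast_add_one, hU, show m - 1 = U.card by omega]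
    ring
  rw [orderProb, if_neg (Finset.notMem_empty r), meanPredecessors, Finset.compl_empty, ← hUdef,
    Finset.sum_powerset, hU]
  simp only [Finset.empty_union]
  rw [Finset.sum_congr rfl fun i _ => hterm i, Finset.mul_sum]
  refine (Finset.sum_subset (Finset.range_mono hk) fun i _ hi => ?_).symm
  rw [coverCoeffAvoiding_eq_zero hk (not_lt.1 (Finset.mem_range.not.1 hi)), Nat.cast_zero,
    zero_div, mul_zero]

end OrderProb

section Law

theorem ae_pi_of_forall_ae_update {ι : Type*} [Fintype ι] [DecidableEq ι] {α : ι → Type*}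
    [∀ i, MeasurableSpace (α i)] {μ : ∀ i, Measure (α i)} [∀ i, SigmaFinite (μ i)]
    {P : (∀ i, α i) → Prop} (hP : MeasurableSet {x | P x}) (i : ι)
    (h : ∀ x, ∀ᵐ u ∂μ i, P (Function.update x i u)) : ∀ᵐ x ∂Measure.pi μ, P x := by
  rcases isEmpty_or_nonempty (∀ i, α i) with hα | ⟨⟨x⟩⟩
  · exact .of_forall fun x => isEmptyElim x
  set N : Set (∀ i, α i) := {x | P x}ᶜ
  have hsection : (fun x => ∫⁻ u, N.indicator 1 (Function.update x i u) ∂μ i) =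
      fun _ => (0 : ENNReal) := by
    funext x
    have hpre : MeasurableSet (Function.update x i ⁻¹' N) := measurable_update x hP.compl
    exact (lintegral_indicator_one hpre).trans (ae_iff.1 (h x))
  change Measure.pi μ N = 0
  rw [← lintegral_indicator_one hP.compl, lintegral_eq_lmarginal_univ x,
    lmarginal_erase' _ (measurable_one.indicator hP.compl) (Finset.mem_univ i), hsection,
    lmarginal, lintegral_zero]

theorem measurePreserving_comp_perm {ι α : Type*} [Fintype ι] [MeasurableSpace α]
    (μ : Measure α) [SigmaFinite μ] (e : Equiv.Perm ι) :
    MeasurePreserving (fun x : ι → α => x ∘ e) (Measure.pi fun _ => μ) (Measure.pi fun _ => μ) :=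
  measurePreserving_arrowCongr' (fun _ => μ) (fun _ => μ) e.symm (.refl α) fun _ => .id μ

variable {m n : ℕ} {Z : Finset (Fin m × Fin n)} {j k : ℕ} {ν : Measure ℝ}

/-- The joint law of the entries outside `Z`, if they are independent with the common law `ν`. -/
noncomputable def entryLaw (ν : Measure ℝ) (Z : Finset (Fin m × Fin n)) :
    Measure ({p // p ∉ Z} → ℝ) :=
  Measure.pi fun _ => ν

instance [IsProbabilityMeasure ν] : IsProbabilityMeasure (entryLaw ν Z) :=
  inferInstanceAs (IsProbabilityMeasure (Measure.pi _))

/-- The matrix with given entries outside `Z` and zeros in `Z`. -/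
def matrixOf (Z : Finset (Fin m × Fin n)) (x : {p // p ∉ Z} → ℝ) : Fin m → Fin n → ℝ :=
  fun i b => if h : (i, b) ∉ Z then x ⟨(i, b), h⟩ else 0

theorem matrixOf_of_mem {x : {p // p ∉ Z} → ℝ} {p : Fin m × Fin n} (hp : p ∈ Z) :
    matrixOf Z x p.1 p.2 = 0 := dif_neg (not_not.2 hp)

theorem matrixOf_of_notMem {x : {p // p ∉ Z} → ℝ} {p : Fin m × Fin n} (hp : p ∉ Z) :
    matrixOf Z x p.1 p.2 = x ⟨p, hp⟩ := dif_pos hp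

theorem measurable_cost_matrixOf (s : Finset (Fin m × Fin n)) :
    Measurable fun x => cost (matrixOf Z x) s := by
  refine Finset.measurable_sum _ fun p _ => ?_
  by_cases hp : p ∈ Z
  · simp only [matrixOf_of_mem hp, measurable_const]
  · simp only [matrixOf_of_notMem hp, measurable_pi_apply]

theorem cost_matrixOf_update_of_notMem {x : {p // p ∉ Z} → ℝ} {p : {p // p ∉ Z}} (u : ℝ)
    {s : Finset (Fin m × Fin n)} (hp : p.1 ∉ s) :
    cost (matrixOf Z (Function.update x p u)) s = cost (matrixOf Z x) s := by
  refine Finset.sum_congr rfl fun q hq => ?_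
  by_cases hqZ : q ∈ Z
  · rw [matrixOf_of_mem hqZ, matrixOf_of_mem hqZ]
  · rw [matrixOf_of_notMem hqZ, matrixOf_of_notMem hqZ, Function.update_of_ne]
    rintro rfl
    exact hp hq

section Generic

theorem ae_cost_matrixOf_ne [SigmaFinite ν] [NullSingletonClass ν] {s t : Finset (Fin m × Fin n)}
    {p : Fin m × Fin n} (hpZ : p ∉ Z) (hps : p ∈ s) (hpt : p ∉ t) :
    ∀ᵐ x ∂entryLaw ν Z, cost (matrixOf Z x) s ≠ cost (matrixOf Z x) t := by
  refine ae_pi_of_forall_ae_update (measurableSet_eq_fun (measurable_cost_matrixOf s)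
    (measurable_cost_matrixOf t)).compl ⟨p, hpZ⟩ fun x => ?_
  filter_upwards [Measure.ae_ne ν (cost (matrixOf Z x) t - cost (matrixOf Z x) (s.erase p))]
    with u hu hcost
  rw [← cost_erase hps, cost_matrixOf_update_of_notMem u (Finset.notMem_erase p s),
    cost_matrixOf_update_of_notMem u hpt, matrixOf_of_notMem hpZ, Function.update_self] at hcost
  exact hu (eq_sub_of_add_eq' hcost)

theorem ae_cost_matrixOf_injOn [SigmaFinite ν] [NullSingletonClass ν]
    (Z : Finset (Fin m × Fin n)) :
    ∀ᵐ x ∂entryLaw ν Z, Set.InjOn (cost (matrixOf Z x)) {s | Disjoint s Z} := by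
  have hne : ∀ s t : Finset (Fin m × Fin n), Disjoint s Z → ¬ s ⊆ t →
      ∀ᵐ x ∂entryLaw ν Z, cost (matrixOf Z x) s ≠ cost (matrixOf Z x) t := fun s t hs hst =>
    let ⟨_, hps, hpt⟩ := Finset.not_subset.1 hst
    ae_cost_matrixOf_ne (Finset.disjoint_left.1 hs hps) hps hpt
  have hsubset : ∀ᵐ x ∂entryLaw ν Z, ∀ s t : Finset (Fin m × Fin n), Disjoint s Z → ¬ s ⊆ t →
      cost (matrixOf Z x) s ≠ cost (matrixOf Z x) t := by
    simpa only [ae_all_iff, Filter.eventually_imp_distrib_left] using hne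
  filter_upwards [hsubset] with x hx s hs t ht hst
  exact (by_contra fun h => hx s t hs h hst).antisymm
    (by_contra fun h => hx t s ht h hst.symm)

theorem ae_isGeneric [IsProbabilityMeasure ν] [NullSingletonClass ν] (hν : ∀ᵐ u ∂ν, 0 ≤ u)
    (Z : Finset (Fin m × Fin n)) : ∀ᵐ x ∂entryLaw ν Z, IsGeneric Z (matrixOf Z x) := by
  have hpos : ∀ᵐ u ∂ν, 0 < u := by
    filter_upwards [hν, Measure.ae_ne ν 0] with u hu hne using hu.lt_of_ne' hne
  have hentry : ∀ᵐ x ∂entryLaw ν Z, ∀ p, 0 < x p := ae_all_iff.2 fun p =>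
    (measurePreserving_eval (fun _ => ν) p).quasiMeasurePreserving.ae hpos
  filter_upwards [hentry, ae_cost_matrixOf_injOn Z] with x hx hinj
  exact ⟨fun p hp => matrixOf_of_mem hp, fun p hp => matrixOf_of_notMem hp ▸ hx _,
    fun s t hs ht h => hinj hs ht h⟩

end Generic

section Measurability

theorem measurable_isOptimal_matrixOf (k : ℕ) :
    Measurable fun x => IsOptimal (matrixOf Z x) k :=
  measurable_pi_iff.2 fun s => Measurable.and measurable_const (Measurable.forall fun t =>
    measurable_const.imp (measurableSet_setOfPred.1 (measurableSet_le (measurable_cost_matrixOf s)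
      (measurable_cost_matrixOf t))))

theorem measurableSet_of_isOptimal (j k : ℕ)
    (Q : (Finset (Fin m × Fin n) → Prop) → (Finset (Fin m × Fin n) → Prop) → Prop) :
    MeasurableSet {x | Q (IsOptimal (matrixOf Z x) j) (IsOptimal (matrixOf Z x) k)} := by
  have hpair := (measurable_isOptimal_matrixOf (Z := Z) j).prodMk (measurable_isOptimal_matrixOf k)
  exact hpair (MeasurableSet.of_discrete (s := {q | Q q.1 q.2}))

end Measurability

section SwapInvariance

variable {F : Finset (Fin m)} {a a' : Fin m}

/-- The permutation of the positions underlying `swapRows`. -/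
def swapPositions (C : Finset (Fin n)) (a a' : Fin m) : Equiv.Perm (Fin m × Fin n) :=
  Equiv.prodCongrLeft fun b => if b ∈ C then 1 else Equiv.swap a a'

theorem swapRows_eq_swapPositions (C : Finset (Fin n)) (a a' : Fin m) (A : Fin m → Fin n → ℝ)
    (p : Fin m × Fin n) : swapRows C a a' A p.1 p.2 =
      A (swapPositions C a a' p).1 (swapPositions C a a' p).2 := by
  by_cases hb : p.2 ∈ C <;> simp [swapRows, swapPositions, hb]

theorem swapPositions_notMem_iff (ha : a ∉ F) (ha' : a' ∉ F) (p : Fin m × Fin n) :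
    swapPositions (zeroCols Z F) a a' p ∉ Z ↔ p ∉ Z := by
  obtain ⟨i, b⟩ := p
  rw [swapPositions, Equiv.prodCongrLeft_apply]
  split_ifs with hb
  · rfl
  · have hF : ∀ i ∉ F, (i, b) ∉ Z := fun i hi h => hb (mem_zeroCols.2 ⟨i, hi, h⟩)
    rw [Equiv.swap_apply_def]
    split_ifs with hia hia'
    · simp only [hia, hF, ha, ha', not_false_eq_true]
    · simp only [hia', hF, ha, ha', not_false_eq_true]
    · rfl

theorem matrixOf_comp_subtypePerm (θ : Equiv.Perm (Fin m × Fin n)) (hθ : ∀ p, θ p ∉ Z ↔ p ∉ Z)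
    (x : {p // p ∉ Z} → ℝ) (p : Fin m × Fin n) :
    matrixOf Z (x ∘ θ.subtypePerm hθ) p.1 p.2 = matrixOf Z x (θ p).1 (θ p).2 := by
  by_cases hp : p ∈ Z
  · rw [matrixOf_of_mem hp, matrixOf_of_mem (not_not.1 ((hθ p).not.2 (not_not.2 hp)))]
  · rw [matrixOf_of_notMem hp, matrixOf_of_notMem ((hθ p).2 hp), Function.comp_apply,
      Equiv.Perm.subtypePerm_apply]

theorem exists_measurePreserving_swapRows [SigmaFinite ν] (ha : a ∉ F) (ha' : a' ∉ F) :
    ∃ T, MeasurePreserving T (entryLaw ν Z) (entryLaw ν Z) ∧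
      ∀ x, matrixOf Z (T x) = swapRows (zeroCols Z F) a a' (matrixOf Z x) := by
  let θ := (swapPositions (zeroCols Z F) a a').subtypePerm (p := (· ∉ Z))
    (swapPositions_notMem_iff ha ha')
  refine ⟨fun x => x ∘ θ, measurePreserving_comp_perm ν θ, fun x => ?_⟩
  funext i b
  exact (matrixOf_comp_subtypePerm _ (swapPositions_notMem_iff ha ha') x (i, b)).trans
    (swapRows_eq_swapPositions _ a a' (matrixOf Z x) (i, b)).symm

end SwapInvariance

section NewRow

variable {F : Finset (Fin m)} {a a' : Fin m}

/-- The event that `F` are the common rows of the optimal `j`-assignments, and that an optimal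
`(j + 1)`-assignment has a nonzero element in the row `a`. -/
def newRowEvent (Z : Finset (Fin m × Fin n)) (j : ℕ) (F : Finset (Fin m)) (a : Fin m) :
    Set ({p // p ∉ Z} → ℝ) :=
  {x | commonRows (matrixOf Z x) j = F ∧ HasNonzeroInRow (matrixOf Z x) Z (j + 1) a}

open scoped Classical in
theorem measurableSet_newRowEvent (F : Finset (Fin m)) (a : Fin m) :
    MeasurableSet (newRowEvent Z j F a) :=
  measurableSet_of_isOptimal j (j + 1) fun O O' =>
    ({i | ∀ s, O s → UsesRow s i} : Finset (Fin m)) = F ∧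
      ∃ s, O' s ∧ ∃ b, (a, b) ∈ s ∧ (a, b) ∉ Z

variable [IsProbabilityMeasure ν] [NullSingletonClass ν]

theorem measureReal_newRowEvent_le (hν : ∀ᵐ u ∂ν, 0 ≤ u) (hj : j + 1 ≤ min m n)
    (hZ : NoZeroAssignment Z (j + 1)) (ha : a ∉ F) (ha' : a' ∉ F) :
    (entryLaw ν Z).real (newRowEvent Z j F a) ≤ (entryLaw ν Z).real (newRowEvent Z j F a') := by
  obtain ⟨T, hT, hTswap⟩ := exists_measurePreserving_swapRows (ν := ν) (Z := Z) ha ha'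
  rw [← hT.measureReal_preimage (measurableSet_newRowEvent F a').nullMeasurableSet]
  refine ENNReal.toReal_mono (measure_ne_top _ _) (measure_mono_ae ?_)
  filter_upwards [ae_isGeneric hν Z, hT.quasiMeasurePreserving.ae (ae_isGeneric hν Z)]
    with x hx hTx hmem
  obtain ⟨rfl, hnew⟩ := hmem
  rw [hTswap] at hTx
  change T x ∈ newRowEvent Z j _ a'
  rw [newRowEvent, Set.mem_ofPred_eq, hTswap]
  exact ⟨hx.commonRows_swapRows hj hZ ha ha' hTx, hx.hasNonzeroInRow_swapRows hj hZ ha ha' hnew⟩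

theorem measureReal_newRowEvent_eq_zero (hν : ∀ᵐ u ∂ν, 0 ≤ u) (hj : j + 1 ≤ min m n)
    (hZ : NoZeroAssignment Z (j + 1)) (hF : F.card + (zeroCols Z F).card ≠ j) (a : Fin m) :
    (entryLaw ν Z).real (newRowEvent Z j F a) = 0 := by
  rw [measureReal_def, ENNReal.toReal_eq_zero_iff, measure_eq_zero_iff_ae_notMem]
  left
  filter_upwards [ae_isGeneric hν Z] with x hx hmem
  exact hF (hmem.1 ▸ hx.card_commonRows_add_card_zeroCols hj hZ)

theorem IsGeneric.sum_indicator_newRowEvent {x : {p // p ∉ Z} → ℝ} {w : Finset (Fin m) → Fin m → ℝ}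
    (hx : IsGeneric Z (matrixOf Z x)) (hj : j + 1 ≤ min m n) (hZ : NoZeroAssignment Z (j + 1))
    (ha : a ∉ commonRows (matrixOf Z x) j) (hnew : HasNonzeroInRow (matrixOf Z x) Z (j + 1) a) :
    ∑ F, ∑ b ∈ Fᶜ, (newRowEvent Z j F b).indicator (fun _ => w F b) x =
      w (commonRows (matrixOf Z x) j) a := by
  rw [Finset.sum_eq_single_of_mem _ (Finset.mem_univ (commonRows (matrixOf Z x) j)),
    Finset.sum_eq_single_of_mem a (Finset.mem_compl.2 ha)]
  · exact Set.indicator_of_mem (show x ∈ newRowEvent Z j _ a from ⟨rfl, hnew⟩) _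
  · exact fun b hb hne => Set.indicator_of_notMem (fun hmem => hne ((hx.existsUnique_newRow hj
      hZ).unique ⟨Finset.mem_compl.1 hb, hmem.2⟩ ⟨ha, hnew⟩)) _
  · exact fun F _ hne => Finset.sum_eq_zero fun b _ =>
      Set.indicator_of_notMem (fun hmem => hne hmem.1.symm) _

theorem integral_eq_sum_newRowEvent (hν : ∀ᵐ u ∂ν, 0 ≤ u) (hj : j + 1 ≤ min m n)
    (hZ : NoZeroAssignment Z (j + 1)) (w : Finset (Fin m) → Fin m → ℝ)
    {g : ({p // p ∉ Z} → ℝ) → ℝ}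
    (hg : ∀ᵐ x ∂entryLaw ν Z, ∀ a ∉ commonRows (matrixOf Z x) j,
      HasNonzeroInRow (matrixOf Z x) Z (j + 1) a → g x = w (commonRows (matrixOf Z x) j) a) :
    ∫ x, g x ∂entryLaw ν Z =
      ∑ F : Finset (Fin m), ∑ a ∈ Fᶜ, (entryLaw ν Z).real (newRowEvent Z j F a) * w F a := by
  have hsum : g =ᵐ[entryLaw ν Z] fun x =>
      ∑ F, ∑ b ∈ Fᶜ, (newRowEvent Z j F b).indicator (fun _ => w F b) x := by
    filter_upwards [hg, ae_isGeneric hν Z] with x hgx hx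
    obtain ⟨a, ⟨ha, hnew⟩, -⟩ := hx.existsUnique_newRow hj hZ
    rw [hgx a ha hnew, hx.sum_indicator_newRowEvent hj hZ ha hnew]
  have hint : ∀ F a,
      Integrable ((newRowEvent Z j F a).indicator fun _ => w F a) (entryLaw ν Z) :=
    fun F a => (integrable_const _).indicator (measurableSet_newRowEvent F a)
  rw [integral_congr_ae hsum,
    integral_finsetSum _ fun F _ => integrable_finsetSum _ fun a _ => hint F a]
  refine Finset.sum_congr rfl fun F _ => ?_
  rw [integral_finsetSum _ fun a _ => hint F a]
  refine Finset.sum_congr rfl fun a _ => ?_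
  rw [integral_indicator_const _ (measurableSet_newRowEvent F a), smul_eq_mul]

/-- The new row is uniformly distributed outside the common rows, so a weight whose values at
`insert a F` average to its value at `F` has the same mean before and after adding the new row. -/
theorem integral_insert_newRow (hν : ∀ᵐ u ∂ν, 0 ≤ u) (hj : j + 1 ≤ min m n)
    (hZ : NoZeroAssignment Z (j + 1)) {w : Finset (Fin m) → ℝ}
    (hw : ∀ F : Finset (Fin m), F.card + (zeroCols Z F).card = j →
      ∑ a ∈ Fᶜ, w (insert a F) = Fᶜ.card * w F)
    {g : ({p // p ∉ Z} → ℝ) → ℝ}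
    (hg : ∀ᵐ x ∂entryLaw ν Z, ∀ a ∉ commonRows (matrixOf Z x) j,
      HasNonzeroInRow (matrixOf Z x) Z (j + 1) a →
        g x = w (insert a (commonRows (matrixOf Z x) j))) :
    ∫ x, g x ∂entryLaw ν Z = ∫ x, w (commonRows (matrixOf Z x) j) ∂entryLaw ν Z := by
  rw [integral_eq_sum_newRowEvent hν hj hZ (fun F a => w (insert a F)) hg,
    integral_eq_sum_newRowEvent hν hj hZ (fun F _ => w F) (.of_forall fun _ _ _ _ => rfl)]
  refine Finset.sum_congr rfl fun F _ => ?_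
  by_cases hF : F.card + (zeroCols Z F).card = j
  · rcases Fᶜ.eq_empty_or_nonempty with hempty | ⟨a₀, ha₀⟩
    · rw [hempty, Finset.sum_empty, Finset.sum_empty]
    have huniform : ∀ a ∈ Fᶜ, (entryLaw ν Z).real (newRowEvent Z j F a) =
        (entryLaw ν Z).real (newRowEvent Z j F a₀) := fun a ha => by
      rw [Finset.mem_compl] at ha ha₀
      exact (measureReal_newRowEvent_le hν hj hZ ha ha₀).antisymm
        (measureReal_newRowEvent_le hν hj hZ ha₀ ha)
    have hfactor : ∀ v : Fin m → ℝ, ∑ a ∈ Fᶜ, (entryLaw ν Z).real (newRowEvent Z j F a) * v a =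
        (entryLaw ν Z).real (newRowEvent Z j F a₀) * ∑ a ∈ Fᶜ, v a := fun v => by
      rw [Finset.mul_sum]
      exact Finset.sum_congr rfl fun a ha => by rw [huniform a ha]
    rw [hfactor, hfactor, hw F hF, Finset.sum_const, nsmul_eq_mul]
  · simp only [measureReal_newRowEvent_eq_zero hν hj hZ hF, zero_mul]

end NewRow

end Law

section RowProbability

variable {m n : ℕ} {A : Fin m → Fin n → ℝ} {Z t : Finset (Fin m × Fin n)} {j k l : ℕ} {r : Fin m}

section ZeroAssignment

theorem IsAssignment.le_card_of_covers (ht : IsAssignment k t) (htZ : t ⊆ Z) {R : Finset (Fin m)}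
    {C : Finset (Fin n)} (h : Covers Z R C) : k ≤ R.card + C.card := by
  rw [← ht.card_eq]
  exact card_le_of_forall_mem_or ht.isMatching fun p hp => h p (htZ hp)

theorem IsGeneric.isOptimal_of_subset (hA : IsGeneric Z A) (ht : IsAssignment k t)
    (htZ : t ⊆ Z) : IsOptimal A k t := by
  refine ⟨ht, fun u _ => ?_⟩
  have hcost : cost A t = 0 := Finset.sum_eq_zero fun p hp => hA.zero p (htZ hp)
  rw [hcost]
  exact Finset.sum_nonneg fun p _ => hA.nonneg p

theorem IsGeneric.notMem_commonRows_of_subset (hA : IsGeneric Z A) (ht : IsAssignment k t)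
    (htZ : t ⊆ Z) (hr : ∀ b, (r, b) ∉ Z) : r ∉ commonRows A k := fun h =>
  let ⟨b, hb⟩ := mem_commonRows.1 h t (hA.isOptimal_of_subset ht htZ)
  hr b (htZ hb)

theorem NoZeroAssignment.exists_max (h : NoZeroAssignment Z k) :
    ∃ j < k, (∃ t ⊆ Z, IsAssignment j t) ∧ NoZeroAssignment Z (j + 1) := by
  induction k with
  | zero => exact absurd (Finset.empty_subset Z) (h ∅ ⟨rfl, by simp, by simp⟩)
  | succ k ih =>
    by_cases hk : NoZeroAssignment Z k
    · obtain ⟨j, hj, hmax⟩ := ih hk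
      exact ⟨j, hj.trans k.lt_succ_self, hmax⟩
    · simp only [NoZeroAssignment] at hk
      push Not at hk
      obtain ⟨t, ht, htZ⟩ := hk
      exact ⟨k, k.lt_succ_self, ⟨t, htZ, ht⟩, h⟩

end ZeroAssignment

section Martingale

variable {a : Fin m}

theorem IsGeneric.orderProb_commonRows_of_subset (hA : IsGeneric Z A) (hj : j + 1 ≤ min m n)
    (hZ : NoZeroAssignment Z (j + 1)) (ht : IsAssignment j t) (htZ : t ⊆ Z)
    (hr : ∀ b, (r, b) ∉ Z) : orderProb Z k r (commonRows A j) = orderProb Z k r ∅ := by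
  have hrF := hA.notMem_commonRows_of_subset ht htZ hr
  have heq := orderProb_union_eq (Z := Z) (k := k) (B := ∅) (r := r)
    ((Finset.empty_union (commonRows A j)).symm ▸ hrF) fun S hS => by
      rw [Finset.empty_union]
      exact hS.union_of_minimal (Finset.empty_subset _) (covers_zeroCols Z _) fun R C _ hRC =>
        (hA.card_commonRows_add_card_zeroCols hj hZ).le.trans (ht.le_card_of_covers htZ hRC)
  rwa [Finset.empty_union] at heq

theorem IsGeneric.insert_newRow_subset (hA : IsGeneric Z A) (hj : j + 1 ≤ min m n)
    (hZ : NoZeroAssignment Z (j + 1)) (hnew : HasNonzeroInRow A Z (j + 1) a) :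
    insert a (commonRows A j) ⊆ commonRows A (j + 1) :=
  Finset.insert_subset (hA.mem_commonRows_of_hasNonzeroInRow hnew)
    (hA.commonRows_subset_succ hj hZ)

theorem IsGeneric.mem_insert_newRow (hA : IsGeneric Z A) (hj : j + 1 ≤ min m n)
    (hZ : NoZeroAssignment Z (j + 1)) (hr : ∀ b, (r, b) ∉ Z) (ha : a ∉ commonRows A j)
    (hnew : HasNonzeroInRow A Z (j + 1) a) (h : r ∈ commonRows A (j + 1)) :
    r ∈ insert a (commonRows A j) := by
  by_cases hrj : r ∈ commonRows A j
  · exact Finset.mem_insert_of_mem hrj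
  · rw [(hA.existsUnique_newRow hj hZ).unique
      ⟨hrj, hasNonzeroInRow_of_mem_commonRows hj hr h⟩ ⟨ha, hnew⟩]
    exact Finset.mem_insert_self _ _

theorem IsGeneric.orderProb_commonRows_succ (hA : IsGeneric Z A) (hj : j + 2 ≤ min m n)
    (hZ : NoZeroAssignment Z (j + 1)) (hr : ∀ b, (r, b) ∉ Z) (ha : a ∉ commonRows A j)
    (hnew : HasNonzeroInRow A Z (j + 1) a) :
    orderProb Z k r (commonRows A (j + 1)) = orderProb Z k r (insert a (commonRows A j)) := by
  have hj' : j + 1 ≤ min m n := by omega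
  have hsub := hA.insert_newRow_subset hj' hZ hnew
  have hunion := Finset.union_eq_right.2 hsub
  by_cases hrF : r ∈ commonRows A (j + 1)
  · rw [orderProb_of_mem hrF, orderProb_of_mem (hA.mem_insert_newRow hj' hZ hr ha hnew hrF)]
  · rw [← hunion]
    refine orderProb_union_eq (hunion.symm ▸ hrF) fun S hS => hunion.symm ▸ ?_
    refine hS.union_of_minimal hsub (covers_zeroCols Z _) fun R C hR hRC => ?_
    rw [hA.card_commonRows_add_card_zeroCols hj (hZ.mono (Nat.le_succ _))]
    exact hA.lt_card_cover ha ((Finset.subset_insert _ _).trans hR)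
      (hR (Finset.mem_insert_self _ _)) hRC

theorem IsGeneric.orderProb_insert_newRow_of_notMem (hA : IsGeneric Z A) (hj : j + 1 ≤ min m n)
    (hZ : NoZeroAssignment Z (j + 1)) (ha : a ∉ commonRows A j)
    (hnew : HasNonzeroInRow A Z (j + 1) a) (hr : r ∉ commonRows A (j + 1)) :
    orderProb Z (j + 1) r (insert a (commonRows A j)) = 0 := by
  refine orderProb_of_not_hasSmallCover (fun h => hr (hA.insert_newRow_subset hj hZ hnew h)) ?_
  rintro ⟨R, C, hR, hRC, hcard⟩
  have hlt := hA.lt_card_cover ha ((Finset.subset_insert _ _).trans hR)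
    (hR (Finset.mem_insert_self _ _)) hRC
  omega

theorem sum_orderProb_insert_of_card (r : Fin m) (hjk : j < k) {F : Finset (Fin m)}
    (hF : F.card + (zeroCols Z F).card = j) :
    ∑ a ∈ Fᶜ, orderProb Z k r (insert a F) = Fᶜ.card * orderProb Z k r F :=
  sum_orderProb_insert r ⟨F, _, subset_rfl, covers_zeroCols Z F, hF.trans_lt hjk⟩

end Martingale

section EntryLaw

variable {ν : Measure ℝ} [IsProbabilityMeasure ν] [NullSingletonClass ν]

theorem integral_orderProb_commonRows (hν : ∀ᵐ u ∂ν, 0 ≤ u) (ht : IsAssignment j t) (htZ : t ⊆ Z)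
    (hZ : NoZeroAssignment Z (j + 1)) (hk : k ≤ min m n) (hr : ∀ b, (r, b) ∉ Z) (hjl : j ≤ l)
    (hlk : l < k) :
    ∫ x, orderProb Z k r (commonRows (matrixOf Z x) l) ∂entryLaw ν Z = orderProb Z k r ∅ := by
  induction l, hjl using Nat.le_induction with
  | base =>
    have hstart : ∀ᵐ x ∂entryLaw ν Z,
        orderProb Z k r (commonRows (matrixOf Z x) j) = orderProb Z k r ∅ := by
      filter_upwards [ae_isGeneric hν Z] with x hx
      exact hx.orderProb_commonRows_of_subset (by omega) hZ ht htZ hr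
    rw [integral_congr_ae hstart, integral_const, probReal_univ, one_smul]
  | succ l hjl ih =>
    have hZl := hZ.mono (Nat.succ_le_succ hjl)
    rw [← ih (by omega)]
    refine integral_insert_newRow hν (j := l) (by omega) hZl
      (fun F hF => sum_orderProb_insert_of_card r (by omega) hF) ?_
    filter_upwards [ae_isGeneric hν Z] with x hx a ha hnew
    exact hx.orderProb_commonRows_succ (by omega) hZl hr ha hnew

theorem measurableSet_mem_commonRows (k : ℕ) (r : Fin m) :
    MeasurableSet {x | r ∈ commonRows (matrixOf Z x) k} := by
  simp only [mem_commonRows]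
  exact measurableSet_of_isOptimal k k fun O _ => ∀ s, O s → UsesRow s r

theorem measureReal_mem_commonRows_succ (hν : ∀ᵐ u ∂ν, 0 ≤ u) (hj : j + 1 ≤ min m n)
    (hZ : NoZeroAssignment Z (j + 1)) (hr : ∀ b, (r, b) ∉ Z) :
    (entryLaw ν Z).real {x | r ∈ commonRows (matrixOf Z x) (j + 1)} =
      ∫ x, orderProb Z (j + 1) r (commonRows (matrixOf Z x) j) ∂entryLaw ν Z := by
  rw [← integral_indicator_one (measurableSet_mem_commonRows (j + 1) r)]
  refine integral_insert_newRow hν hj hZ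
    (fun F hF => sum_orderProb_insert_of_card r j.lt_succ_self hF) ?_
  filter_upwards [ae_isGeneric hν Z] with x hx a ha hnew
  by_cases hrx : r ∈ commonRows (matrixOf Z x) (j + 1)
  · rw [orderProb_of_mem (hx.mem_insert_newRow hj hZ hr ha hnew hrx)]
    exact Set.indicator_of_mem (s := {x | r ∈ commonRows (matrixOf Z x) (j + 1)}) hrx 1
  · rw [hx.orderProb_insert_newRow_of_notMem hj hZ ha hnew hrx]
    exact Set.indicator_of_notMem (s := {x | r ∈ commonRows (matrixOf Z x) (j + 1)}) hrx 1

theorem measureReal_mem_commonRows (hν : ∀ᵐ u ∂ν, 0 ≤ u) (hk : k ≤ min m n)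
    (hr : ∀ b, (r, b) ∉ Z) :
    (entryLaw ν Z).real {x | r ∈ commonRows (matrixOf Z x) k} = orderProb Z k r ∅ := by
  by_cases h : NoZeroAssignment Z k
  · obtain ⟨j, hjk, ⟨t, htZ, ht⟩, hZ⟩ := h.exists_max
    obtain ⟨l, rfl⟩ : ∃ l, k = l + 1 := ⟨k - 1, by omega⟩
    rw [measureReal_mem_commonRows_succ hν hk h hr]
    exact integral_orderProb_commonRows hν ht htZ hZ hk hr (by omega) l.lt_succ_self
  · simp only [NoZeroAssignment] at h
    push Not at h
    obtain ⟨t, ht, htZ⟩ := h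
    have hnull : entryLaw ν Z {x | r ∈ commonRows (matrixOf Z x) k} = 0 :=
      measure_eq_zero_iff_ae_notMem.2 <| by
        filter_upwards [ae_isGeneric hν Z] with x hx
        exact hx.notMem_commonRows_of_subset ht htZ hr
    have hcover : ¬ HasSmallCover Z k ∅ := fun ⟨_, _, _, hRC, hcard⟩ =>
      hcard.not_ge (ht.le_card_of_covers htZ hRC)
    rw [measureReal_def, hnull, orderProb_of_not_hasSmallCover (Finset.notMem_empty r) hcover,
      ENNReal.toReal_zero]

end EntryLaw

section RandomMatrix

variable {Ω : Type*} [MeasurableSpace Ω] {μ : Measure Ω} {ν : Measure ℝ}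
  {X : Fin m → Fin n → Ω → ℝ}

/-- The random matrix `X` vanishes in `Z`, and its other entries are independent with the common law
`ν`; for the exponential law this is the random part of `IsStandardRAP`. -/
structure IsIIDOutside (μ : Measure Ω) (ν : Measure ℝ) (Z : Finset (Fin m × Fin n))
    (X : Fin m → Fin n → Ω → ℝ) : Prop where
  zero : ∀ p ∈ Z, ∀ᵐ ω ∂μ, X p.1 p.2 ω = 0
  law : ∀ p ∉ Z, HasLaw (X p.1 p.2) ν μ
  indep : iIndepFun (fun p : {p : Fin m × Fin n // p ∉ Z} => X p.1.1 p.1.2) μ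

theorem IsStandardRAP.isIIDOutside (hX : IsStandardRAP μ k Z X) :
    IsIIDOutside μ (expMeasure 1) Z X :=
  ⟨hX.zero, hX.law, hX.indep⟩

theorem IsIIDOutside.hasLaw_entries (hX : IsIIDOutside μ ν Z X) :
    HasLaw (fun ω (p : {p // p ∉ Z}) => X p.1.1 p.1.2 ω) (entryLaw ν Z) μ :=
  have := hX.indep.isProbabilityMeasure
  hX.indep.hasLaw_pi fun p => hX.law p.1 p.2

theorem IsIIDOutside.ae_eq_matrixOf (hX : IsIIDOutside μ ν Z X) :
    ∀ᵐ ω ∂μ, (fun i b => X i b ω) = matrixOf Z fun p => X p.1.1 p.1.2 ω := by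
  have hzero : ∀ᵐ ω ∂μ, ∀ p ∈ Z, X p.1 p.2 ω = 0 := by
    simpa only [ae_all_iff, Filter.eventually_imp_distrib_left] using hX.zero
  filter_upwards [hzero] with ω hω
  funext i b
  by_cases hp : (i, b) ∈ Z
  · exact (hω (i, b) hp).trans (matrixOf_of_mem hp).symm
  · rw [matrixOf_of_notMem (p := (i, b)) hp]

variable [IsProbabilityMeasure ν] [NullSingletonClass ν]

theorem IsIIDOutside.ae_isGeneric (hX : IsIIDOutside μ ν Z X) (hν : ∀ᵐ u ∂ν, 0 ≤ u) :
    ∀ᵐ ω ∂μ, IsGeneric Z fun i b => X i b ω := by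
  have hgeneric := RandomAssignment.ae_isGeneric hν Z
  rw [← hX.hasLaw_entries.map_eq] at hgeneric
  filter_upwards [ae_of_ae_map hX.hasLaw_entries.aemeasurable hgeneric, hX.ae_eq_matrixOf]
    with ω hω hmatrix
  exact hmatrix.symm ▸ hω

theorem IsIIDOutside.measureReal_mem_commonRows (hX : IsIIDOutside μ ν Z X)
    (hν : ∀ᵐ u ∂ν, 0 ≤ u) (hk : k ≤ min m n) (hr : ∀ b, (r, b) ∉ Z) :
    μ.real {ω | r ∈ commonRows (fun i b => X i b ω) k} = orderProb Z k r ∅ := by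
  rw [← RandomAssignment.measureReal_mem_commonRows hν hk hr,
    ← hX.hasLaw_entries.measureReal_eq (measurableSet_mem_commonRows k r)]
  refine measureReal_congr ?_
  filter_upwards [hX.ae_eq_matrixOf] with ω hω
  exact congrArg (fun B => r ∈ commonRows B k) hω

theorem IsGeneric.exists_usesRow_iff (hA : IsGeneric Z A) (hk : k ≤ min m n)
    (hr : ∀ b, (r, b) ∉ Z) :
    (∃ s, IsOptimal A k s ∧ UsesRow s r) ↔ r ∈ commonRows A k := by
  constructor
  · rintro ⟨s, hs, b, hb⟩
    exact hA.mem_commonRows_of_mem hs hb (hr b)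
  · intro h
    obtain ⟨s, hs⟩ := exists_isOptimal A hk
    exact ⟨s, hs, mem_commonRows.1 h s hs⟩

end RandomMatrix

section Exponential

instance nullSingletonClass_expMeasure (c : ℝ) : NullSingletonClass (expMeasure c) :=
  nullSingletonClass_withDensity _

theorem ae_nonneg_expMeasure (c : ℝ) : ∀ᵐ u ∂expMeasure c, 0 ≤ u := by
  simp only [ae_iff, not_le]
  change expMeasure c (Set.Iio 0) = 0
  rw [expMeasure, gammaMeasure, withDensity_apply _ measurableSet_Iio]
  exact lintegral_exponentialPDF_of_nonpos le_rfl

end Exponential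

end RowProbability

end RandomAssignment

theorem theoremT_general {Ω : Type*} [MeasurableSpace Ω] (μ : Measure Ω) (ν : Measure ℝ)
    [IsProbabilityMeasure ν] [NullSingletonClass ν] (hν : ∀ᵐ u ∂ν, 0 ≤ u)
    (m n k : ℕ) (hk : k ≤ min m n) (Z : Finset (Fin m × Fin n)) (X : Fin m → Fin n → Ω → ℝ)
    (hX : RandomAssignment.IsIIDOutside μ ν Z X) (r : Fin m) (hr : ∀ j : Fin n, (r, j) ∉ Z) :
    μ.real {ω | ∃ s, RandomAssignment.IsOptimal (fun i j => X i j ω) k s ∧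
        RandomAssignment.UsesRow s r} =
      1 / (m : ℝ) * ∑ i ∈ Finset.range k,
        (RandomAssignment.coverCoeffAvoiding Z k r i 0 : ℝ) / ((m - 1).choose i : ℝ) ∧
    μ.real {ω | ∀ s, RandomAssignment.IsOptimal (fun i j => X i j ω) k s →
        RandomAssignment.UsesRow s r} =
      1 / (m : ℝ) * ∑ i ∈ Finset.range k,
        (RandomAssignment.coverCoeffAvoiding Z k r i 0 : ℝ) / ((m - 1).choose i : ℝ) := by
  rw [← RandomAssignment.orderProb_empty (hk.trans (min_le_left m n)) r,
    ← hX.measureReal_mem_commonRows hν hk hr]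
  constructor
  · refine measureReal_congr ?_
    filter_upwards [hX.ae_isGeneric hν] with ω hω
    exact propext (hω.exists_usesRow_iff hk hr)
  · simp only [RandomAssignment.mem_commonRows]

theorem theoremT {Ω : Type*} [MeasurableSpace Ω] (μ : Measure Ω) [IsProbabilityMeasure μ]
    (m n k : ℕ) (Z : Finset (Fin m × Fin n)) (X : Fin m → Fin n → Ω → ℝ)
    (hP : RandomAssignment.IsStandardRAP μ k Z X)
    (r : Fin m) (hr : ∀ j : Fin n, (r, j) ∉ Z) :
    μ.real {ω | ∃ s, RandomAssignment.IsOptimal (fun i j => X i j ω) k s ∧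
        RandomAssignment.UsesRow s r} =
      1 / (m : ℝ) * ∑ i ∈ Finset.range k,
        (RandomAssignment.coverCoeffAvoiding Z k r i 0 : ℝ) / ((m - 1).choose i : ℝ) ∧
    μ.real {ω | ∀ s, RandomAssignment.IsOptimal (fun i j => X i j ω) k s →
        RandomAssignment.UsesRow s r} =
      1 / (m : ℝ) * ∑ i ∈ Finset.range k,
        (RandomAssignment.coverCoeffAvoiding Z k r i 0 : ℝ) / ((m - 1).choose i : ℝ) := by
  have := isProbabilityMeasure_expMeasure one_pos
  exact theoremT_general μ (expMeasure 1) (RandomAssignment.ae_nonneg_expMeasure 1) m n k hP.le_min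
    Z X hP.isIIDOutside r hr
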